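/- All graphs are finite, simple and undirected. For a graph $G$ of order $n$, let $m(G,k)$ be the number of $k$-matchings of $G$ (sets of $k$ pairwise nonincident edges), and let $\mu(G,x)=\sum_{k\ge 0}(-1)^k m(G,k)x^{n-2k}$ be its matching polynomial. A graph $G$ is matching unique if every graph $H$ with $\mu(H,x)=\mu(G,x)$ is isomorphic to $G$. For integers $r\le s\le 2r$ with $r\ge 1$, let $S(r,s)$ be the connected graph obtained from $r$ disjoint edges by adding one vertex and joining it by $s$ edges to endpoints of these $r$ edges (so it is joined to both ends of $s-r$ of them and to exactly one end of each of the others; this graph is unique up to isomorphism). Let $F_n$ be the friendship graph, which consists of $n$ triangles intersecting in a single vertex. **Theorem.** For every positive integer $s$, the graph $S(\lceil s/2\rceil,s)$ is matching unique if and only if $s\notin\{3,4,5\}$. Moreover, for every positive integer $n$, $F_n\cong S(n,2n)$, and $F_n$ is matching unique whenever $n\ne 2$. -/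

import Mathlib

noncomputable section

/-- The number `m(G, k)` of `k`-matchings of `G`: sets of `k` pairwise nonincident edges. -/
def numMatchings {V : Type*} (G : SimpleGraph V) (k : ℕ) : ℕ :=
  {M : Finset (Sym2 V) | (∀ e ∈ M, e ∈ G.edgeSet) ∧ M.card = k ∧
    ∀ e ∈ M, ∀ f ∈ M, e ≠ f → ∀ v, ¬ (v ∈ e ∧ v ∈ f)}.ncard

/-- The matching polynomial `∑ₖ (-1)ᵏ m(G, k) x ^ (n - 2k)` of a finite graph of order `n`.
There are no `k`-matchings for `2k > n`, so that the sum over `k ≤ n / 2` is the whole sum. -/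
def matchingPolynomial {V : Type*} [Finite V] (G : SimpleGraph V) : Polynomial ℤ :=
  ∑ k ∈ Finset.range (Nat.card V / 2 + 1),
    Polynomial.C ((-1) ^ k * (numMatchings G k : ℤ)) * Polynomial.X ^ (Nat.card V - 2 * k)

/-- Two finite graphs are comatching if they are nonisomorphic and have the same
matching polynomial. -/
def Comatching {V W : Type*} [Finite V] [Finite W] (G : SimpleGraph V) (H : SimpleGraph W) :
    Prop :=
  IsEmpty (G ≃g H) ∧ matchingPolynomial G = matchingPolynomial H

/-- A finite graph is matching unique if no finite graph (on a vertex type in the universe `w`,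
which may be any universe) is comatching with it. -/
def MatchingUnique.{w, v} {V : Type v} [Finite V] (G : SimpleGraph V) : Prop :=
  ∀ (W : Type w) [Finite W] (H : SimpleGraph W), ¬ Comatching G H

/-- The graph `S(r, s)`, for `r ≤ s ≤ 2r`: a vertex `u = none`, and `r` disjoint edges
`{(i, 0), (i, 1)}`, `i < r`, to which `u` is joined by `s` edges so that the graph is connected:
`u` is adjacent to all the `(i, 0)` and to the `s - r` vertices `(i, 1)` with `i < s - r`. -/
def graphS (r s : ℕ) : SimpleGraph (Option (Fin r × Fin 2)) where
  Adj x y := match x, y with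
    | none, none => False
    | none, some (i, a) => a = 0 ∨ r + i < s
    | some (i, a), none => a = 0 ∨ r + i < s
    | some (i, a), some (j, b) => i = j ∧ a ≠ b
  symm := ⟨by
    rintro (_ | ⟨i, a⟩) (_ | ⟨j, b⟩) h
    · exact h
    · exact h
    · exact h
    · exact ⟨h.1.symm, h.2.symm⟩⟩
  loopless := ⟨by
    rintro (_ | ⟨i, a⟩) h
    · exact h
    · exact h.2 rfl⟩

/-- The friendship graph `F_n`: the `n` triangles `{none, (i, 0), (i, 1)}`, `i < n`, which
intersect in the single vertex `none`. -/
def friendshipGraph (n : ℕ) : SimpleGraph (Option (Fin n × Fin 2)) where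
  Adj x y := x ≠ y ∧ ∃ i : Fin n,
    x ∈ ({none, some (i, 0), some (i, 1)} : Set (Option (Fin n × Fin 2))) ∧
    y ∈ ({none, some (i, 0), some (i, 1)} : Set (Option (Fin n × Fin 2)))
  symm := ⟨fun _ _ h => ⟨h.1.symm, h.2.imp fun _ hi => ⟨hi.2, hi.1⟩⟩⟩
  loopless := ⟨fun _ h => h.1 rfl⟩

end

universe w

/-! Expanding at the centre gives μ(S(k+1, s)) = X(X² - 1)^k(X² - 1 - s). Let H have this
polynomial, with s = 2k+1 or 2k+2. It suffices to find a vertex b whose deletion leaves disjoint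
edges: expanding at b then shows that b has degree s, so b misses at most one vertex and H is
determined (`nonempty_iso_graphS`).

For s ≤ 2 the order is three and any edge gives such a b. For s ≥ 6 the tool is Godsil's theorem
that deleting a path lowers the multiplicity of a matching root by at most one
(`pow_dvd_muOn_sdiff_path`). It is proved by bounding the square of the polynomial of the remainder
by a Wronskian. Applied to the roots 1 and -1, it shows by degrees that no path has six vertices,
that the complement of a path on five vertices has polynomial (X² - 1)^(k-1), and that the
complement of a path on four vertices has polynomial X(X² - 1)^(k-1). Counting edges, these
complements are disjoint edges, in the latter case together with one isolated vertex w.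

A path a b c d exists because H has more edges than vertices while 0 is a simple root. If one of the
remaining edges is attached to b or c, the bounds on paths force that vertex to be the required
centre (`inducesPerfectMatching_erase_of_path`). Otherwise {a, b, c, d, w} is a union of components
with polynomial X(X² - 1)(X² - 1 - s), and counting 2-matchings on five vertices gives s ≤ 5.

For s = 3, 4, 5 explicit comates are given; the case s = 2n yields the friendship graphs. -/

open Polynomial

/-! ### Matching polynomials of induced subgraphs -/

section MatchingPolynomialOfSubset

variable {V W : Type*}

open Classical in
/-- The matchings of `G` all of whose edges have both ends in `S`. -/
noncomputable def matchingsOn (G : SimpleGraph V) (S : Finset V) : Finset (Finset (Sym2 V)) :=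
  S.sym2.powerset.filter fun M => (∀ e ∈ M, e ∈ G.edgeSet) ∧
    ∀ e ∈ M, ∀ f ∈ M, e ≠ f → ∀ v, ¬ (v ∈ e ∧ v ∈ f)

/-- The matching polynomial of the subgraph of `G` induced on `S`. -/
noncomputable def muOn (G : SimpleGraph V) (S : Finset V) : ℝ[X] :=
  ∑ M ∈ matchingsOn G S, (-1) ^ M.card * X ^ (S.card - 2 * M.card)

theorem mem_matchingsOn {G : SimpleGraph V} {S : Finset V} {M : Finset (Sym2 V)} :
    M ∈ matchingsOn G S ↔ (∀ e ∈ M, ∀ v ∈ e, v ∈ S) ∧ (∀ e ∈ M, e ∈ G.edgeSet) ∧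
      ∀ e ∈ M, ∀ f ∈ M, e ≠ f → ∀ v, ¬ (v ∈ e ∧ v ∈ f) := by
  simp [matchingsOn, Finset.subset_iff, Finset.mem_sym2_iff]

theorem two_mul_card_le_of_mem_matchingsOn {G : SimpleGraph V} {S : Finset V}
    {M : Finset (Sym2 V)} (hM : M ∈ matchingsOn G S) : 2 * M.card ≤ S.card := by
  classical
  obtain ⟨h1, h2, h3⟩ := mem_matchingsOn.1 hM
  have hd : (M.biUnion Sym2.toFinset).card = ∑ e ∈ M, e.toFinset.card := by
    refine Finset.card_biUnion fun e he f hf hef => ?_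
    rw [Function.onFun, Finset.disjoint_left]
    intro v hv hv'
    exact h3 e he f hf hef v ⟨Sym2.mem_toFinset.1 hv, Sym2.mem_toFinset.1 hv'⟩
  have h2' : ∑ e ∈ M, e.toFinset.card = ∑ e ∈ M, 2 := by
    refine Finset.sum_congr rfl fun e he => ?_
    exact Sym2.card_toFinset_of_not_isDiag e (G.not_isDiag_of_mem_edgeSet (h2 e he))
  rw [h2', Finset.sum_const, smul_eq_mul] at hd
  rw [mul_comm, ← hd]
  refine Finset.card_le_card fun v hv => ?_
  obtain ⟨e, he, hve⟩ := Finset.mem_biUnion.1 hv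
  exact h1 e he v (Sym2.mem_toFinset.1 hve)

/-- A matching either misses `u` or covers it by exactly one edge, whose removal leaves a matching
avoiding both ends. This is the source of the vertex recursion `muOn_insert`. -/
theorem matchingsOn_insert [DecidableEq V] (G : SimpleGraph V) [DecidableRel G.Adj] {u : V}
    {S : Finset V}
    (hu : u ∉ S) :
    matchingsOn G (insert u S) = matchingsOn G S ∪
      (S.filter (G.Adj u)).biUnion fun v =>
        (matchingsOn G (S.erase v)).image (insert s(u, v)) := by
  ext M
  simp only [Finset.mem_union, Finset.mem_biUnion, Finset.mem_image, Finset.mem_filter]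
  constructor
  · intro hM
    obtain ⟨h1, h2, h3⟩ := mem_matchingsOn.1 hM
    by_cases h : ∃ e ∈ M, u ∈ e
    · obtain ⟨e, he, hue⟩ := h
      right
      obtain ⟨v, rfl⟩ := Sym2.mem_iff_exists.1 hue
      have huv : G.Adj u v := h2 _ he
      have hvS : v ∈ S := by
        have := h1 _ he v (by simp)
        rcases Finset.mem_insert.1 this with h | h
        · exact absurd h.symm huv.ne
        · exact h
      refine ⟨v, ⟨hvS, huv⟩, M.erase s(u, v), ?_, Finset.insert_erase he⟩
      refine mem_matchingsOn.2 ⟨fun f hf x hx => ?_,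
        fun f hf => h2 f (Finset.mem_of_mem_erase hf), fun f hf g hg =>
        h3 f (Finset.mem_of_mem_erase hf) g (Finset.mem_of_mem_erase hg)⟩
      have hfM := Finset.mem_of_mem_erase hf
      have hne := Finset.ne_of_mem_erase hf
      have hxu : x ≠ u := by
        rintro rfl
        exact h3 f hfM _ he hne x ⟨hx, by simp⟩
      have hxv : x ≠ v := by
        rintro rfl
        exact h3 f hfM _ he hne x ⟨hx, by simp⟩
      exact Finset.mem_erase.2 ⟨hxv, Finset.mem_of_mem_insert_of_ne (h1 f hfM x hx) hxu⟩
    · left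
      push Not at h
      refine mem_matchingsOn.2 ⟨fun e he v hv => ?_, h2, h3⟩
      refine Finset.mem_of_mem_insert_of_ne (h1 e he v hv) ?_
      rintro rfl
      exact h e he hv
  · rintro (hM | ⟨v, ⟨hvS, huv⟩, N, hN, rfl⟩)
    · obtain ⟨h1, h2, h3⟩ := mem_matchingsOn.1 hM
      exact mem_matchingsOn.2
        ⟨fun e he v hv => Finset.mem_insert_of_mem (h1 e he v hv), h2, h3⟩
    · obtain ⟨h1, h2, h3⟩ := mem_matchingsOn.1 hN
      have key : ∀ f ∈ N, ∀ x, x ∈ s(u, v) → x ∉ f := by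
        intro f hf x hx hxf
        have := Finset.mem_erase.1 (h1 f hf x hxf)
        rcases Sym2.mem_iff.1 hx with rfl | rfl
        · exact hu this.2
        · exact this.1 rfl
      refine mem_matchingsOn.2 ⟨?_, ?_, ?_⟩
      · intro e he x hx
        rcases Finset.mem_insert.1 he with rfl | he
        · rcases Sym2.mem_iff.1 hx with rfl | rfl
          · simp
          · exact Finset.mem_insert_of_mem hvS
        · exact Finset.mem_insert_of_mem (Finset.mem_of_mem_erase (h1 e he x hx))
      · intro e he
        rcases Finset.mem_insert.1 he with rfl | he
        · exact huv
        · exact h2 e he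
      · intro e he f hf hef x hx
        rcases Finset.mem_insert.1 he with rfl | he <;> rcases Finset.mem_insert.1 hf with rfl | hf
        · exact hef rfl
        · exact key f hf x hx.1 hx.2
        · exact key e he x hx.2 hx.1
        · exact h3 e he f hf hef x hx

theorem muOn_insert [DecidableEq V] (G : SimpleGraph V) [DecidableRel G.Adj] {u : V}
    {S : Finset V} (hu : u ∉ S) :
    muOn G (insert u S) = X * muOn G S - ∑ v ∈ S with G.Adj u v, muOn G (S.erase v) := by
  have hnot : ∀ T ⊆ S, ∀ N ∈ matchingsOn G T, ∀ v, s(u, v) ∉ N := by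
    intro T hT N hN v hv
    exact hu (hT ((mem_matchingsOn.1 hN).1 _ hv u (by simp)))
  rw [muOn, matchingsOn_insert G hu, Finset.sum_union, Finset.sum_biUnion, sub_eq_add_neg,
    ← Finset.sum_neg_distrib]
  · congr 1
    · rw [muOn, Finset.mul_sum]
      refine Finset.sum_congr rfl fun M hM => ?_
      -- The exponents are truncated differences, so this bound is needed to split off a factor X.
      have := two_mul_card_le_of_mem_matchingsOn hM
      rw [Finset.card_insert_of_notMem hu, show S.card + 1 - 2 * M.card =
        (S.card - 2 * M.card) + 1 by omega, pow_succ]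
      ring
    · refine Finset.sum_congr rfl fun v hv => ?_
      have hvS := (Finset.mem_filter.1 hv).1
      rw [Finset.sum_image, muOn, ← Finset.sum_neg_distrib]
      · refine Finset.sum_congr rfl fun N hN => ?_
        rw [Finset.card_insert_of_notMem (hnot _ (Finset.erase_subset _ _) N hN v),
          Finset.card_insert_of_notMem hu, Finset.card_erase_of_mem hvS,
          show S.card + 1 - 2 * (N.card + 1) = S.card - 1 - 2 * N.card by omega, pow_succ]
        ring
      · intro N hN N' hN' h
        rw [← Finset.erase_insert (hnot _ (Finset.erase_subset _ _) N hN v),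
          ← Finset.erase_insert (hnot _ (Finset.erase_subset _ _) N' hN' v)]
        exact congrArg (fun M => M.erase s(u, v)) h
  · intro v hv v' hv' hne
    rw [Function.onFun, Finset.disjoint_left]
    intro M hM hM'
    obtain ⟨N, hN, rfl⟩ := Finset.mem_image.1 hM
    obtain ⟨N', hN', h⟩ := Finset.mem_image.1 hM'
    have h1 : s(u, v') ∈ insert s(u, v) N := h ▸ Finset.mem_insert_self _ _
    rcases Finset.mem_insert.1 h1 with h2 | h2
    · exact hne (Sym2.congr_right.1 h2).symm
    · exact hnot _ (Finset.erase_subset _ _) N hN v' h2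
  · rw [Finset.disjoint_left]
    intro M hM hM'
    obtain ⟨v, hv, h⟩ := Finset.mem_biUnion.1 hM'
    obtain ⟨N, hN, rfl⟩ := Finset.mem_image.1 h
    exact hnot _ subset_rfl _ hM v (Finset.mem_insert_self _ _)

theorem muOn_empty (G : SimpleGraph V) : muOn G ∅ = 1 := by
  have : matchingsOn G ∅ = {∅} := by
    ext M
    simp only [matchingsOn, Finset.sym2_empty, Finset.powerset_empty, Finset.mem_filter,
      Finset.mem_singleton]
    constructor
    · exact fun h => h.1
    · rintro rfl
      simp
  simp [muOn, this]

/-- Passing to real coefficients loses no information and makes the pointwise inequalities of the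
multiplicity argument available. -/
theorem map_matchingPolynomial [Fintype V] (G : SimpleGraph V) :
    (matchingPolynomial G).map (Int.castRingHom ℝ) = muOn G Finset.univ := by
  have hmaps : ∀ M ∈ matchingsOn G Finset.univ, M.card ∈ Finset.range (Nat.card V / 2 + 1) := by
    intro M hM
    have := two_mul_card_le_of_mem_matchingsOn hM
    rw [Finset.card_univ, ← Nat.card_eq_fintype_card] at this
    rw [Finset.mem_range]
    omega
  rw [muOn, matchingPolynomial, ← Finset.sum_fiberwise_of_maps_to hmaps, Polynomial.map_sum]
  refine Finset.sum_congr rfl fun k _ => ?_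
  have hc : numMatchings G k = ((matchingsOn G Finset.univ).filter (fun M => M.card = k)).card := by
    rw [numMatchings, ← Set.ncard_coe_finset]
    congr 1
    ext M
    simp only [Finset.coe_filter, mem_matchingsOn, Set.mem_ofPred_eq, Finset.mem_univ]
    tauto
  rw [hc, Finset.sum_congr rfl (g := fun _ => (-1) ^ k * X ^ (Nat.card V - 2 * k))]
  · rw [Finset.sum_const]
    simp
    ring
  · intro M hM
    rw [(Finset.mem_filter.1 hM).2, Finset.card_univ, Nat.card_eq_fintype_card]

theorem matchingPolynomial_eq_iff [Fintype V] [Fintype W] (G : SimpleGraph V)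
    (H : SimpleGraph W) :
    matchingPolynomial G = matchingPolynomial H ↔ muOn G Finset.univ = muOn H Finset.univ := by
  rw [← map_matchingPolynomial, ← map_matchingPolynomial]
  exact (Polynomial.map_injective _ Int.cast_injective).eq_iff.symm

end MatchingPolynomialOfSubset

/-! ### Consequences of the vertex recursion: degree, parity, unions, edge count -/

section Recursion

variable {V W : Type*} [DecidableEq V] [DecidableEq W] (G : SimpleGraph V) [DecidableRel G.Adj]

theorem muOn_insert_of_isolated {u : V} {S : Finset V} (hu : u ∉ S)
    (h : ∀ v ∈ S, ¬ G.Adj u v) : muOn G (insert u S) = X * muOn G S := by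
  rw [muOn_insert G hu, Finset.filter_false_of_mem h]
  simp

theorem muOn_insert_of_leaf {u v : V} {S : Finset V} (hu : u ∉ S) (hv : v ∈ S) (huv : G.Adj u v)
    (h : ∀ x ∈ S, G.Adj u x → x = v) :
    muOn G (insert u S) = X * muOn G S - muOn G (S.erase v) := by
  rw [muOn_insert G hu]
  have : S.filter (G.Adj u) = {v} := by
    ext x
    simp only [Finset.mem_filter, Finset.mem_singleton]
    exact ⟨fun hx => h x hx.1 hx.2, by rintro rfl; exact ⟨hv, huv⟩⟩
  simp [this]

theorem muOn_monic_and_natDegree (S : Finset V) :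
    (muOn G S).Monic ∧ (muOn G S).natDegree = S.card := by
  induction h : S.card using Nat.strong_induction_on generalizing S with
  | _ n ih =>
    rcases S.eq_empty_or_nonempty with rfl | ⟨u, hu⟩
    · simp only [Finset.card_empty] at h
      simp [muOn_empty, ← h]
    · obtain ⟨T, huT, rfl⟩ : ∃ T, u ∉ T ∧ insert u T = S :=
        ⟨S.erase u, Finset.notMem_erase u S, Finset.insert_erase hu⟩
      rw [Finset.card_insert_of_notMem huT] at h
      rw [muOn_insert G huT]
      obtain ⟨h1, h2⟩ := ih T.card (by omega) T rfl
      have h3 : (X * muOn G T).Monic := monic_X.mul h1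
      have h4 : (X * muOn G T).natDegree = n := by
        rw [monic_X.natDegree_mul h1, h2, natDegree_X]
        omega
      have h5 : (∑ v ∈ T with G.Adj u v, muOn G (T.erase v)).degree <
          (X * muOn G T).degree := by
        rw [degree_eq_natDegree h3.ne_zero, h4]
        refine mem_degreeLT.1 (Submodule.sum_mem _ fun v hv => mem_degreeLT.2 ?_)
        have hvT := (Finset.mem_filter.1 hv).1
        have hc := Finset.card_erase_of_mem hvT
        have hp := Finset.card_pos.2 ⟨v, hvT⟩
        obtain ⟨h6, h7⟩ := ih (T.erase v).card (by omega) (T.erase v) rfl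
        rw [degree_eq_natDegree h6.ne_zero, h7]
        exact_mod_cast (by omega : (T.erase v).card < n)
      refine ⟨h3.sub_of_left h5, ?_⟩
      rw [natDegree_sub_eq_left_of_natDegree_lt, h4]
      by_cases h0 : (∑ v ∈ T with G.Adj u v, muOn G (T.erase v)) = 0
      · rw [h0, h4, natDegree_zero]
        omega
      · exact natDegree_lt_natDegree h0 h5

theorem muOn_monic (S : Finset V) : (muOn G S).Monic := (muOn_monic_and_natDegree G S).1

theorem natDegree_muOn (S : Finset V) : (muOn G S).natDegree = S.card :=
  (muOn_monic_and_natDegree G S).2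

theorem coeff_card_muOn (S : Finset V) : (muOn G S).coeff S.card = 1 := by
  rw [← natDegree_muOn G S]
  exact muOn_monic G S

theorem eval_neg_muOn (S : Finset V) (x : ℝ) :
    (muOn G S).eval (-x) = (-1) ^ S.card * (muOn G S).eval x := by
  induction h : S.card using Nat.strong_induction_on generalizing S with
  | _ n ih =>
    rcases S.eq_empty_or_nonempty with rfl | ⟨u, hu⟩
    · simp only [Finset.card_empty] at h
      simp [muOn_empty, ← h]
    · obtain ⟨T, huT, rfl⟩ : ∃ T, u ∉ T ∧ insert u T = S :=
        ⟨S.erase u, Finset.notMem_erase u S, Finset.insert_erase hu⟩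
      rw [Finset.card_insert_of_notMem huT] at h
      rw [muOn_insert G huT, eval_sub, eval_sub, eval_mul, eval_mul, eval_X, eval_X,
        eval_finsetSum, eval_finsetSum, ih T.card (by omega) T rfl, mul_sub, Finset.mul_sum,
        ← h, pow_succ]
      congr 1
      · ring
      · refine Finset.sum_congr rfl fun v hv => ?_
        have hvT := (Finset.mem_filter.1 hv).1
        have hp := Finset.card_pos.2 ⟨v, hvT⟩
        have hc := Finset.card_erase_of_mem hvT
        rw [ih (T.erase v).card (by omega) _ rfl, hc]
        obtain ⟨k, hk⟩ : ∃ k, T.card = k + 1 := ⟨T.card - 1, by omega⟩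
        rw [hk, Nat.add_sub_cancel, pow_succ]
        ring

theorem muOn_union {S T : Finset V} (hd : Disjoint S T) (h : ∀ x ∈ S, ∀ y ∈ T, ¬ G.Adj x y) :
    muOn G (S ∪ T) = muOn G S * muOn G T := by
  induction hn : S.card using Nat.strong_induction_on generalizing S with
  | _ n ih =>
    rcases S.eq_empty_or_nonempty with rfl | ⟨u, hu⟩
    · simp [muOn_empty]
    · obtain ⟨S, huS, rfl⟩ : ∃ S', u ∉ S' ∧ insert u S' = S :=
        ⟨S.erase u, Finset.notMem_erase u S, Finset.insert_erase hu⟩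
      rw [Finset.card_insert_of_notMem huS] at hn
      rw [Finset.disjoint_insert_left] at hd
      have hu' : u ∉ S ∪ T := by simp [huS, hd.1]
      have hS : ∀ x ∈ S, ∀ y ∈ T, ¬ G.Adj x y := fun x hx => h x (Finset.mem_insert_of_mem hx)
      rw [Finset.insert_union, muOn_insert G hu', muOn_insert G huS,
        ih S.card (by omega) hd.2 hS rfl, sub_mul, mul_assoc, Finset.sum_mul]
      congr 1
      have hf : (S ∪ T).filter (G.Adj u) = S.filter (G.Adj u) := by
        rw [Finset.filter_union, Finset.filter_false_of_mem (h u (Finset.mem_insert_self _ _)),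
          Finset.union_empty]
      rw [hf]
      refine Finset.sum_congr rfl fun v hv => ?_
      have hvS := (Finset.mem_filter.1 hv).1
      have hp := Finset.card_pos.2 ⟨v, hvS⟩
      have hc := Finset.card_erase_of_mem hvS
      have hvT : v ∉ T := Finset.disjoint_left.1 hd.2 hvS
      rw [Finset.erase_union_distrib, Finset.erase_eq_of_notMem hvT, ih (S.erase v).card (by omega)
        (hd.2.mono_left (Finset.erase_subset _ _))
        (fun x hx => hS x (Finset.mem_of_mem_erase hx)) rfl]

theorem muOn_map (H : SimpleGraph W) [DecidableRel H.Adj] (f : V ↪ W)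
    (hf : ∀ x y, H.Adj (f x) (f y) ↔ G.Adj x y) (S : Finset V) :
    muOn H (S.map f) = muOn G S := by
  induction h : S.card using Nat.strong_induction_on generalizing S with
  | _ n ih =>
    rcases S.eq_empty_or_nonempty with rfl | ⟨u, hu⟩
    · simp [muOn_empty]
    · obtain ⟨T, huT, rfl⟩ : ∃ T, u ∉ T ∧ insert u T = S :=
        ⟨S.erase u, Finset.notMem_erase u S, Finset.insert_erase hu⟩
      rw [Finset.card_insert_of_notMem huT] at h
      rw [Finset.map_insert, muOn_insert H (by simpa using huT), muOn_insert G huT,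
        ih T.card (by omega) T rfl, Finset.filter_map, Finset.sum_map]
      congr 1
      refine Finset.sum_congr (by ext; simp [hf]) fun v hv => ?_
      have hvT : v ∈ T := (Finset.mem_filter.1 hv).1
      have hp := Finset.card_pos.2 ⟨v, hvT⟩
      have hc := Finset.card_erase_of_mem hvT
      rw [← Finset.map_erase, ih (T.erase v).card (by omega) _ rfl]

/-- The second coefficient is minus the number of edges, expressed through the degree sum. -/
theorem two_mul_coeff_muOn (S : Finset V) (n : ℕ) (h : S.card = n + 2) :
    2 * (muOn G S).coeff n = - ∑ v ∈ S, ((S.filter (G.Adj v)).card : ℝ) := by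
  -- The extra factor X shifts the index so that the induction can start at a single vertex.
  have aux : ∀ (n : ℕ) (S : Finset V), S.card = n + 1 →
      2 * (X * muOn G S).coeff n = - ∑ v ∈ S, ((S.filter (G.Adj v)).card : ℝ) := by
    intro n
    induction n with
    | zero =>
      intro S h
      obtain ⟨v, rfl⟩ := Finset.card_eq_one.1 h
      simp [Finset.filter_singleton]
    | succ n ih =>
      intro S h
      have hne : S.Nonempty := Finset.card_pos.1 (by omega)
      obtain ⟨u, hu⟩ := hne
      obtain ⟨T, huT, rfl⟩ : ∃ T, u ∉ T ∧ insert u T = S :=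
        ⟨S.erase u, Finset.notMem_erase u S, Finset.insert_erase hu⟩
      rw [Finset.card_insert_of_notMem huT, add_left_inj] at h
      have h1 : (∑ v ∈ T with G.Adj u v, muOn G (T.erase v)).coeff n =
          (T.filter (G.Adj u)).card := by
        rw [finsetSum_coeff, Finset.sum_congr rfl (g := fun _ => (1 : ℝ))]
        · simp
        · intro v hv
          have hvT : v ∈ T := (Finset.mem_filter.1 hv).1
          have hc := Finset.card_erase_of_mem hvT
          rw [h, Nat.add_sub_cancel] at hc
          rw [← hc, coeff_card_muOn]
      have h2 : ∀ v ∈ T, (((insert u T).filter (G.Adj v)).card : ℝ) =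
          (T.filter (G.Adj v)).card + if G.Adj u v then 1 else 0 := by
        intro v hv
        rw [Finset.filter_insert]
        by_cases huv : G.Adj u v
        · rw [if_pos huv.symm, if_pos huv, Finset.card_insert_of_notMem (by simp [huT])]
          push_cast
          ring
        · rw [if_neg fun h => huv h.symm, if_neg huv, add_zero]
      have h3 : (insert u T).filter (G.Adj u) = T.filter (G.Adj u) := by
        rw [Finset.filter_insert, if_neg (G.irrefl)]
      rw [coeff_X_mul, muOn_insert G huT, coeff_sub, h1, mul_sub, ih T h,
        Finset.sum_insert huT, Finset.sum_congr rfl h2, Finset.sum_add_distrib,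
        Finset.sum_boole, h3]
      ring
  rw [← aux (n + 1) S h, coeff_X_mul]

theorem exists_adj_of_eval_zero_ne {S : Finset V} (h : (muOn G S).eval 0 ≠ 0) {v : V}
    (hv : v ∈ S) : ∃ u ∈ S, G.Adj v u := by
  by_contra! hno
  apply h
  rw [← Finset.insert_erase hv, muOn_insert_of_isolated G (Finset.notMem_erase v S)
    fun u hu => hno u (Finset.mem_of_mem_erase hu)]
  simp

end Recursion

/-! ### Graphs consisting of disjoint edges -/

section PerfectMatching

variable {V : Type*} [DecidableEq V]

/-- The subgraph of `G` induced on `S` is a disjoint union of edges. -/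
def InducesPerfectMatching {V : Type*} (G : SimpleGraph V) (S : Finset V) : Prop :=
  ∀ v ∈ S, ∃! u, u ∈ S ∧ G.Adj v u

theorem InducesPerfectMatching.erase {G : SimpleGraph V} {S : Finset V}
    (h : InducesPerfectMatching G S) {u v : V} (hu : u ∈ S) (hv : v ∈ S) (huv : G.Adj u v) :
    InducesPerfectMatching G ((S.erase u).erase v) := by
  intro x hx
  simp only [Finset.mem_erase] at hx
  obtain ⟨y, ⟨hy, hxy⟩, huniq⟩ := h x hx.2.2
  refine ⟨y, ⟨?_, hxy⟩, fun z hz => huniq z ⟨?_, hz.2⟩⟩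
  · simp only [Finset.mem_erase]
    refine ⟨?_, ?_, hy⟩
    · rintro rfl
      exact hx.2.1 ((h y hv).unique ⟨hx.2.2, hxy.symm⟩ ⟨hu, huv.symm⟩)
    · rintro rfl
      exact hx.1 ((h y hu).unique ⟨hx.2.2, hxy.symm⟩ ⟨hv, huv⟩)
  · simp only [Finset.mem_erase] at hz
    exact hz.1.2.2

variable {G : SimpleGraph V} [DecidableRel G.Adj]

theorem InducesPerfectMatching.muOn_erase_aux {S : Finset V} (h : InducesPerfectMatching G S)
    {u v : V} (hu : u ∈ S) (hv : v ∈ S) (huv : G.Adj u v) :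
    muOn G (S.erase u) = X * muOn G ((S.erase u).erase v) := by
  have hv' : v ∈ S.erase u := Finset.mem_erase.2 ⟨huv.ne.symm, hv⟩
  conv_lhs => rw [← Finset.insert_erase hv']
  refine muOn_insert_of_isolated G (Finset.notMem_erase _ _) fun x hx hvx => ?_
  simp only [Finset.mem_erase] at hx
  exact hx.2.1 ((h v hv).unique ⟨hx.2.2, hvx⟩ ⟨hu, huv.symm⟩)

theorem InducesPerfectMatching.muOn_eq {S : Finset V} (h : InducesPerfectMatching G S) {c : ℕ}
    (hc : S.card = 2 * c) : muOn G S = (X ^ 2 - 1) ^ c := by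
  induction c generalizing S with
  | zero =>
    rw [mul_zero, Finset.card_eq_zero] at hc
    simp [hc, muOn_empty]
  | succ c ih =>
    obtain ⟨u, hu⟩ : S.Nonempty := Finset.card_pos.1 (by omega)
    obtain ⟨v, ⟨hv, huv⟩, huniq⟩ := h u hu
    have hv' : v ∈ S.erase u := Finset.mem_erase.2 ⟨huv.ne.symm, hv⟩
    have h1 := muOn_insert_of_leaf G (Finset.notMem_erase u S) hv' huv
      fun x hx hux => huniq x ⟨Finset.mem_of_mem_erase hx, hux⟩
    rw [Finset.insert_erase hu, h.muOn_erase_aux hu hv huv, ih (h.erase hu hv huv)] at h1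
    · rw [h1]
      ring
    · rw [Finset.card_erase_of_mem hv', Finset.card_erase_of_mem hu]
      omega

theorem InducesPerfectMatching.muOn_erase {S : Finset V} (h : InducesPerfectMatching G S) {c : ℕ}
    (hc : S.card = 2 * c) {u : V} (hu : u ∈ S) :
    muOn G (S.erase u) = X * (X ^ 2 - 1) ^ (c - 1) := by
  obtain ⟨v, ⟨hv, huv⟩, -⟩ := h u hu
  have hv' : v ∈ S.erase u := Finset.mem_erase.2 ⟨huv.ne.symm, hv⟩
  rw [h.muOn_erase_aux hu hv huv, (h.erase hu hv huv).muOn_eq]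
  rw [Finset.card_erase_of_mem hv', Finset.card_erase_of_mem hu]
  omega

/-- Only the number of neighbours of `b` enters, since deleting any one vertex from disjoint edges
gives the same polynomial. -/
theorem InducesPerfectMatching.muOn_insert {S : Finset V} (h : InducesPerfectMatching G S) {c : ℕ}
    (hc : S.card = 2 * c) (hpos : 0 < c) {b : V} (hb : b ∉ S) :
    muOn G (insert b S) =
      X * (X ^ 2 - 1) ^ (c - 1) * (X ^ 2 - 1 - ((S.filter (G.Adj b)).card : ℝ[X])) := by
  rw [_root_.muOn_insert G hb, h.muOn_eq hc, Finset.sum_congr rfl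
    (fun v hv => h.muOn_erase hc (Finset.mem_filter.1 hv).1), Finset.sum_const, nsmul_eq_mul]
  obtain ⟨k, rfl⟩ : ∃ k, c = k + 1 := ⟨c - 1, by omega⟩
  rw [Nat.add_sub_cancel]
  ring

theorem coeff_sq_sub_one_pow (c : ℕ) :
    ((X ^ 2 - 1 : ℝ[X]) ^ (c + 1)).coeff (2 * c) = -(c + 1 : ℝ) := by
  have h : (X ^ 2 - 1 : ℝ[X]) ^ (c + 1) = expand ℝ 2 ((X + C (-1)) ^ (c + 1)) := by
    simp [sub_eq_add_neg]
  rw [h, mul_comm 2 c, coeff_expand_mul (by norm_num), coeff_X_add_C_pow]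
  simp

/-- A nonzero value at 0 excludes isolated vertices, and the second coefficient makes the degree sum
equal to the number of vertices; hence all degrees are 1. -/
theorem inducesPerfectMatching_of_muOn {S : Finset V} {c : ℕ} (hc : S.card = 2 * c)
    (h : muOn G S = (X ^ 2 - 1) ^ c) : InducesPerfectMatching G S := by
  intro v hv
  obtain ⟨k, rfl⟩ : ∃ k, c = k + 1 := by
    have := Finset.card_pos.2 ⟨v, hv⟩
    exact ⟨c - 1, by omega⟩
  have h1 : ∀ u ∈ S, 1 ≤ (S.filter (G.Adj u)).card := by
    intro u hu
    obtain ⟨w, hw, huw⟩ := exists_adj_of_eval_zero_ne G (S := S) (by simp [h]) hu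
    exact Finset.card_pos.2 ⟨w, Finset.mem_filter.2 ⟨hw, huw⟩⟩
  have h2 := two_mul_coeff_muOn G S (2 * k) (by omega)
  rw [h, coeff_sq_sub_one_pow] at h2
  have h3 : ∑ u ∈ S, (S.filter (G.Adj u)).card = ∑ u ∈ S, 1 := by
    rw [Finset.sum_const, hc, smul_eq_mul]
    have : (∑ u ∈ S, ((S.filter (G.Adj u)).card : ℝ)) = 2 * (k + 1) * 1 := by linarith
    exact_mod_cast this
  have h4 := (Finset.sum_eq_sum_iff_of_le h1).1 h3.symm v hv
  obtain ⟨w, hw⟩ := Finset.card_eq_one.1 h4.symm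
  have h5 : ∀ x, (x ∈ S ∧ G.Adj v x) ↔ x = w := fun x => by
    rw [← Finset.mem_filter, hw, Finset.mem_singleton]
  exact ⟨w, (h5 w).2 rfl, fun x hx => (h5 x).1 hx⟩

/-- There are only `c` edges, too few to cover `2 * c + 1` vertices. -/
theorem exists_isolated_of_muOn {S : Finset V} {c : ℕ} (hc : S.card = 2 * c + 1)
    (h : muOn G S = X * (X ^ 2 - 1) ^ c) : ∃ w ∈ S, ∀ v ∈ S, ¬ G.Adj w v := by
  by_contra! hno
  have h1 : ∑ u ∈ S, 1 ≤ ∑ u ∈ S, (S.filter (G.Adj u)).card := by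
    refine Finset.sum_le_sum fun u hu => ?_
    obtain ⟨w, hw, huw⟩ := hno u hu
    exact Finset.card_pos.2 ⟨w, Finset.mem_filter.2 ⟨hw, huw⟩⟩
  rw [Finset.sum_const, smul_eq_mul, hc, mul_one] at h1
  rcases c with _ | k
  · obtain ⟨x, rfl⟩ := Finset.card_eq_one.1 hc
    obtain ⟨v, hv, hxv⟩ := hno x (by simp)
    rw [Finset.mem_singleton] at hv
    exact hxv.ne hv.symm
  · have h2 := two_mul_coeff_muOn G S (2 * k + 1) (by omega)
    rw [h, coeff_X_mul, coeff_sq_sub_one_pow] at h2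
    have h3 : (2 * (k + 1) + 1 : ℝ) ≤ ∑ u ∈ S, ((S.filter (G.Adj u)).card : ℝ) := by
      exact_mod_cast h1
    linarith

end PerfectMatching

/-! ### Path deletion and the multiplicity of matching roots -/

section Multiplicity

/-- The multiplicity of a root of f² is even, which is why `c = 2 * k - 1` already suffices. The
factors are split off one at a time. -/
theorem pow_dvd_of_sq_le {θ : ℝ} (k : ℕ) :
    ∀ (c : ℕ) (f g : ℝ[X]), 2 * k ≤ c + 1 →
      (∀ x : ℝ, f.eval x ^ 2 ≤ (x - θ) ^ c * g.eval x) → (X - C θ) ^ k ∣ f := by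
  induction k with
  | zero => simp
  | succ k ih =>
    intro c f g hc h
    have h0 : f.eval θ = 0 := by
      have := h θ
      rw [sub_self, zero_pow (by omega), zero_mul] at this
      exact pow_eq_zero_iff two_ne_zero |>.1 (le_antisymm this (sq_nonneg _))
    obtain ⟨f', rfl⟩ := dvd_iff_isRoot.2 h0
    rw [pow_succ, mul_comm]
    refine mul_dvd_mul_left _ ?_
    rcases Nat.eq_zero_or_pos k with rfl | hk
    · simp
    obtain ⟨d, rfl⟩ : ∃ d, c = d + 2 := ⟨c - 2, by omega⟩
    refine ih d f' g (by omega) ?_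
    have hle : ∀ x ∈ ({θ}ᶜ : Set ℝ), f'.eval x ^ 2 ≤ (x - θ) ^ d * g.eval x := by
      intro x hx
      have hpos : 0 < (x - θ) ^ 2 := by
        have : x - θ ≠ 0 := sub_ne_zero.2 hx
        positivity
      refine le_of_mul_le_mul_left ?_ hpos
      have := h x
      simp only [eval_mul, eval_sub, eval_X, eval_C] at this
      calc (x - θ) ^ 2 * f'.eval x ^ 2 = ((x - θ) * f'.eval x) ^ 2 := by ring
        _ ≤ _ := this
        _ = _ := by ring
    -- Division by (x - θ)² is only possible away from θ; continuity restores the inequality at θ.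
    have hcl : IsClosed {x : ℝ | f'.eval x ^ 2 ≤ (x - θ) ^ d * g.eval x} :=
      isClosed_le (by fun_prop) (by fun_prop)
    have hd : Dense ({θ}ᶜ : Set ℝ) := dense_compl_singleton θ
    intro x
    exact hcl.closure_subset_iff.2 hle (hd x)

theorem pow_dvd_derivative {θ : ℝ} {k : ℕ} {f : ℝ[X]} (h : (X - C θ) ^ (k + 1) ∣ f) :
    (X - C θ) ^ k ∣ derivative f := by
  obtain ⟨g, rfl⟩ := h
  rw [derivative_mul, derivative_X_sub_C_pow, Nat.add_sub_cancel]
  exact dvd_add ((Dvd.intro _ (by ring : (X - C θ) ^ k * (C ((k + 1 : ℕ) : ℝ) * g) = _)))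
    (Dvd.intro ((X - C θ) * derivative g) (by ring))

/-- A bootstrap: if (X - θ)^k divides `q`, then (X - θ)^(m+k) divides the Wronskian, so q² ≤ W
raises k by one as long as k < m. At k = m the Wronskian is divisible by (X - θ)^(2m), which gives
the claim for `R`. -/
theorem pow_dvd_of_sq_le_wronskian {θ : ℝ} {m : ℕ} {p q R : ℝ[X]}
    (hp : (X - C θ) ^ (m + 1) ∣ p)
    (hq : ∀ x : ℝ, q.eval x ^ 2 ≤ (derivative p * q - p * derivative q).eval x)
    (hR : ∀ x : ℝ, R.eval x ^ 2 ≤ (derivative p * q - p * derivative q).eval x) :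
    (X - C θ) ^ m ∣ R := by
  have hW : ∀ k ≤ m, (X - C θ) ^ k ∣ q →
      (X - C θ) ^ (m + k) ∣ derivative p * q - p * derivative q := by
    intro k hk hqk
    refine dvd_sub ?_ ?_
    · rw [pow_add]
      exact mul_dvd_mul (pow_dvd_derivative hp) hqk
    · rcases k with _ | k
      · exact Dvd.dvd.mul_right ((pow_dvd_pow _ (by omega)).trans hp) _
      · rw [show m + (k + 1) = (m + 1) + k by ring, pow_add]
        exact mul_dvd_mul hp (pow_dvd_derivative hqk)
  have key : ∀ k c (f : ℝ[X]), 2 * k ≤ c + 1 →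
      (X - C θ) ^ c ∣ derivative p * q - p * derivative q →
      (∀ x : ℝ, f.eval x ^ 2 ≤ (derivative p * q - p * derivative q).eval x) →
      (X - C θ) ^ k ∣ f := by
    rintro k c f hkc ⟨g, hg⟩ hf
    refine pow_dvd_of_sq_le k c f g hkc fun x => ?_
    have := hf x
    rw [hg] at this
    simpa using this
  have hqk : ∀ k ≤ m, (X - C θ) ^ k ∣ q := by
    intro k
    induction k with
    | zero => simp
    | succ k ih =>
      intro hk
      exact key (k + 1) (m + k) q (by omega) (hW k (by omega) (ih (by omega))) hq
  exact key m (m + m) R (by omega) (hW m le_rfl (hqk m le_rfl)) hR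

variable {V : Type*} [DecidableEq V] (G : SimpleGraph V) [DecidableRel G.Adj]

/-- The Wronskian of the matching polynomials of `insert u S` and of `S`. -/
noncomputable def wronskianOn {V : Type*} [DecidableEq V] (G : SimpleGraph V) (u : V)
    (S : Finset V) : ℝ[X] :=
  derivative (muOn G (insert u S)) * muOn G S - muOn G (insert u S) * derivative (muOn G S)

/-- Iterating this identity writes the Wronskian as a sum of squares over the paths starting at `u`,
each path contributing the polynomial of its complement. Hence it is nonnegative and bounds each
such square. -/
theorem wronskianOn_eq {u : V} {S : Finset V} (hu : u ∉ S) :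
    wronskianOn G u S =
      muOn G S ^ 2 + ∑ v ∈ S with G.Adj u v, wronskianOn G v (S.erase v) := by
  have h : ∑ v ∈ S with G.Adj u v, wronskianOn G v (S.erase v) =
      derivative (muOn G S) * (∑ v ∈ S with G.Adj u v, muOn G (S.erase v)) -
      muOn G S * derivative (∑ v ∈ S with G.Adj u v, muOn G (S.erase v)) := by
    rw [derivative_sum, Finset.mul_sum, Finset.mul_sum, ← Finset.sum_sub_distrib]
    refine Finset.sum_congr rfl fun v hv => ?_
    rw [wronskianOn, Finset.insert_erase (Finset.mem_filter.1 hv).1]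
  rw [h, wronskianOn, muOn_insert G hu, derivative_sub, derivative_mul, derivative_X]
  ring

theorem eval_wronskianOn_nonneg {u : V} {S : Finset V} (hu : u ∉ S) (x : ℝ) :
    0 ≤ (wronskianOn G u S).eval x := by
  induction h : S.card generalizing u S with
  | zero =>
    rw [Finset.card_eq_zero] at h
    subst h
    rw [wronskianOn_eq G hu]
    simp [sq_nonneg]
  | succ n ih =>
    rw [wronskianOn_eq G hu, eval_add, eval_finsetSum, eval_pow]
    refine add_nonneg (sq_nonneg _) (Finset.sum_nonneg fun v hv => ?_)
    refine ih (Finset.notMem_erase _ _) ?_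
    rw [Finset.card_erase_of_mem (Finset.mem_filter.1 hv).1, h, Nat.add_sub_cancel]

theorem sq_le_eval_wronskianOn {u : V} {S : Finset V} (hu : u ∉ S) (x : ℝ) :
    (muOn G S).eval x ^ 2 ≤ (wronskianOn G u S).eval x := by
  rw [wronskianOn_eq G hu, eval_add, eval_finsetSum, eval_pow]
  exact le_add_of_nonneg_right (Finset.sum_nonneg fun v _ =>
    eval_wronskianOn_nonneg G (Finset.notMem_erase _ _) x)

theorem eval_wronskianOn_le {u v : V} {S : Finset V} (hu : u ∉ S) (hv : v ∈ S) (huv : G.Adj u v)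
    (x : ℝ) : (wronskianOn G v (S.erase v)).eval x ≤ (wronskianOn G u S).eval x := by
  rw [wronskianOn_eq G hu, eval_add, eval_finsetSum, eval_pow]
  refine le_add_of_nonneg_of_le (sq_nonneg _) ?_
  exact Finset.single_le_sum (f := fun v => (wronskianOn G v (S.erase v)).eval x)
    (fun w _ => eval_wronskianOn_nonneg G (Finset.notMem_erase _ _) x)
    (Finset.mem_filter.2 ⟨hv, huv⟩)

theorem sq_le_eval_wronskianOn_of_isChain {u : V} {S : Finset V} (hu : u ∉ S) (l : List V)
    (hc : (u :: l).IsChain G.Adj) (hl : l.Nodup) (hlS : ∀ v ∈ l, v ∈ S) (x : ℝ) :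
    (muOn G (S \ l.toFinset)).eval x ^ 2 ≤ (wronskianOn G u S).eval x := by
  induction l generalizing u S with
  | nil => simpa using sq_le_eval_wronskianOn G hu x
  | cons v l ih =>
    rw [List.isChain_cons_cons] at hc
    rw [List.nodup_cons] at hl
    refine le_trans ?_ (eval_wronskianOn_le G hu (hlS v (by simp)) hc.1 x)
    have := ih (Finset.notMem_erase v S) hc.2 hl.2 fun w hw =>
      Finset.mem_erase.2 ⟨fun h => hl.1 (h ▸ hw), hlS w (by simp [hw])⟩
    rwa [show S \ (v :: l).toFinset = S.erase v \ l.toFinset by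
      ext; simp [and_assoc]; tauto]

/-- Removing a path lowers the multiplicity of a matching root by at most one. -/
theorem pow_dvd_muOn_sdiff_path {S : Finset V} {θ : ℝ} {m : ℕ}
    (h : (X - C θ) ^ (m + 1) ∣ muOn G S) {l : List V} (hne : l ≠ [])
    (hc : l.IsChain G.Adj) (hl : l.Nodup) (hlS : ∀ v ∈ l, v ∈ S) :
    (X - C θ) ^ m ∣ muOn G (S \ l.toFinset) := by
  obtain ⟨u, l, rfl⟩ := List.exists_cons_of_ne_nil hne
  rw [List.nodup_cons] at hl
  have huS := hlS u (by simp)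
  have hu := Finset.notMem_erase u S
  rw [← Finset.insert_erase huS] at h
  refine pow_dvd_of_sq_le_wronskian h (q := muOn G (S.erase u))
    (fun x => sq_le_eval_wronskianOn G hu x) fun x => ?_
  have := sq_le_eval_wronskianOn_of_isChain G hu l hc hl.2 (fun w hw =>
      Finset.mem_erase.2 ⟨fun h => hl.1 (h ▸ hw), hlS w (by simp [hw])⟩) x
  rwa [show S \ (u :: l).toFinset = S.erase u \ l.toFinset by
    ext; simp [and_assoc]; tauto]

end Multiplicity

/-! ### Explicit formulas up to five vertices -/

section FiveVertices

variable {V : Type*} [DecidableEq V] (G : SimpleGraph V) [DecidableRel G.Adj]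

/-- The entries of the adjacency matrix as real constants. -/
def adjInd {V : Type*} (G : SimpleGraph V) [DecidableRel G.Adj] (x y : V) : ℝ :=
  if G.Adj x y then 1 else 0

theorem muOn_insert_adjInd {u : V} {S : Finset V} (hu : u ∉ S) :
    muOn G (insert u S) =
      X * muOn G S - ∑ v ∈ S, C (adjInd G u v) * muOn G (S.erase v) := by
  rw [muOn_insert G hu, Finset.sum_filter]
  congr 1
  refine Finset.sum_congr rfl fun v _ => ?_
  rw [adjInd]
  split_ifs <;> simp

theorem muOn_singleton (a : V) : muOn G {a} = X := by
  have := muOn_insert_adjInd G (u := a) (S := ∅) (by simp)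
  simpa [muOn_empty] using this

theorem muOn_pair {a b : V} (h : [a, b].Nodup) : muOn G {a, b} = X ^ 2 - C (adjInd G a b) := by
  simp only [List.nodup_cons, List.mem_cons, List.not_mem_nil, or_false] at h
  rw [muOn_insert_adjInd G (by simpa using h.1), muOn_singleton]
  simp [muOn_empty]
  ring

theorem muOn_triple {a b c : V} (h : [a, b, c].Nodup) :
    muOn G {a, b, c} = X ^ 3 - C (adjInd G a b + adjInd G a c + adjInd G b c) * X := by
  simp only [List.nodup_cons, List.mem_cons, List.not_mem_nil, or_false, not_or] at h
  have e1 : ({b, c} : Finset V).erase b = {c} := by ext; simp; grind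
  have e2 : ({b, c} : Finset V).erase c = {b} := by ext; simp; grind
  rw [muOn_insert_adjInd G (by simp; tauto), muOn_pair G (by simp; tauto),
    Finset.sum_insert (by simp; tauto), Finset.sum_singleton, e1, e2, muOn_singleton,
    muOn_singleton]
  simp only [map_add]
  ring

theorem muOn_quadruple {a b c d : V} (h : [a, b, c, d].Nodup) :
    muOn G {a, b, c, d} = X ^ 4 - C (adjInd G a b + adjInd G a c + adjInd G a d + adjInd G b c +
      adjInd G b d + adjInd G c d) * X ^ 2 + C (adjInd G a b * adjInd G c d +
      adjInd G a c * adjInd G b d + adjInd G a d * adjInd G b c) := by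
  simp only [List.nodup_cons, List.mem_cons, List.not_mem_nil, or_false, not_or] at h
  have e1 : ({b, c, d} : Finset V).erase b = {c, d} := by ext; simp; grind
  have e2 : ({b, c, d} : Finset V).erase c = {b, d} := by ext; simp; grind
  have e3 : ({b, c, d} : Finset V).erase d = {b, c} := by ext; simp; grind
  rw [muOn_insert_adjInd G (by simp; tauto), muOn_triple G (by simp; tauto),
    Finset.sum_insert (by simp; tauto), Finset.sum_insert (by simp; tauto),
    Finset.sum_singleton, e1, e2, e3, muOn_pair G (by simp; tauto),
    muOn_pair G (by simp; tauto), muOn_pair G (by simp; tauto)]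
  simp only [map_add, map_mul]
  ring

theorem muOn_quintuple {a b c d e : V} (h : [a, b, c, d, e].Nodup) :
    muOn G {a, b, c, d, e} = X ^ 5 - C (adjInd G a b + adjInd G a c + adjInd G a d +
      adjInd G a e + adjInd G b c + adjInd G b d + adjInd G b e + adjInd G c d + adjInd G c e +
      adjInd G d e) * X ^ 3 + C (
        adjInd G a b * (adjInd G c d + adjInd G c e + adjInd G d e) +
        adjInd G a c * (adjInd G b d + adjInd G b e + adjInd G d e) +
        adjInd G a d * (adjInd G b c + adjInd G b e + adjInd G c e) +
        adjInd G a e * (adjInd G b c + adjInd G b d + adjInd G c d) +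
        (adjInd G b c * adjInd G d e + adjInd G b d * adjInd G c e +
          adjInd G b e * adjInd G c d)) * X := by
  simp only [List.nodup_cons, List.mem_cons, List.not_mem_nil, or_false, not_or] at h
  have e1 : ({b, c, d, e} : Finset V).erase b = {c, d, e} := by ext; simp; grind
  have e2 : ({b, c, d, e} : Finset V).erase c = {b, d, e} := by ext; simp; grind
  have e3 : ({b, c, d, e} : Finset V).erase d = {b, c, e} := by ext; simp; grind
  have e4 : ({b, c, d, e} : Finset V).erase e = {b, c, d} := by ext; simp; grind
  rw [muOn_insert_adjInd G (by simp; tauto), muOn_quadruple G (by simp; tauto),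
    Finset.sum_insert (by simp; tauto), Finset.sum_insert (by simp; tauto),
    Finset.sum_insert (by simp; tauto),
    Finset.sum_singleton, e1, e2, e3, e4, muOn_triple G (by simp; tauto),
    muOn_triple G (by simp; tauto), muOn_triple G (by simp; tauto), muOn_triple G (by simp; tauto)]
  simp only [map_add, map_mul]
  ring

theorem le_five_of_muOn_quintuple {a b c d e : V} (h : [a, b, c, d, e].Nodup) {s : ℕ}
    (hmu : muOn G {a, b, c, d, e} = X * (X ^ 2 - 1) * (X ^ 2 - 1 - (s : ℝ[X]))) : s ≤ 5 := by
  rw [muOn_quintuple G h] at hmu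
  have h1 := congrArg (eval 1) hmu
  have h2 := congrArg (eval 2) hmu
  simp only [eval_add, eval_sub, eval_mul, eval_pow, eval_X, eval_C, eval_one,
    eval_natCast] at h1 h2
  -- With e edges and p 2-matchings, the two evaluations amount to e = s + 2 and p = e - 1. Each of
  -- the ten pairs of vertices occurs in three of the fifteen products, so this bound sums to p ≥ 3e
  -- - 15, whence e ≤ 7.
  have key : ∀ x y z w : V,
      adjInd G x y + adjInd G z w - 1 ≤ adjInd G x y * adjInd G z w := by
    intro x y z w
    simp only [adjInd]
    split_ifs <;> norm_num
  have : (s : ℝ) ≤ 5 := by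
    linarith [key a b c d, key a b c e, key a b d e, key a c b d, key a c b e, key a c d e,
      key a d b c, key a d b e, key a d c e, key a e b c, key a e b d, key a e c d,
      key b c d e, key b d c e, key b e c d]
  exact_mod_cast this

end FiveVertices

/-! ### Paths when a power of X² - 1 divides the polynomial -/

section Paths

variable {V : Type*} [DecidableEq V] [Fintype V] (G : SimpleGraph V) [DecidableRel G.Adj]

theorem sq_sub_one_pow_dvd_muOn_sdiff_path {m : ℕ}
    (h : (X ^ 2 - 1) ^ (m + 1) ∣ muOn G Finset.univ) {l : List V} (hne : l ≠ [])
    (hc : l.IsChain G.Adj) (hl : l.Nodup) :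
    (X ^ 2 - 1) ^ m ∣ muOn G (Finset.univ \ l.toFinset) := by
  have hf : ∀ n, (X ^ 2 - 1 : ℝ[X]) ^ n = (X - C 1) ^ n * (X - C (-1)) ^ n := by
    intro n
    rw [← mul_pow]
    congr 1
    simp
    ring
  rw [hf] at h ⊢
  refine IsCoprime.mul_dvd ?_
    (pow_dvd_muOn_sdiff_path G (dvd_of_mul_right_dvd h) hne hc hl fun v _ => Finset.mem_univ v)
    (pow_dvd_muOn_sdiff_path G (dvd_of_mul_left_dvd h) hne hc hl fun v _ => Finset.mem_univ v)
  exact (isCoprime_X_sub_C_of_isUnit_sub (by norm_num)).pow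

theorem monic_sq_sub_one_pow (m : ℕ) : ((X ^ 2 - 1 : ℝ[X]) ^ m).Monic :=
  (monic_X_pow_sub_C (1 : ℝ) two_ne_zero).pow m

theorem natDegree_sq_sub_one_pow (m : ℕ) : ((X ^ 2 - 1 : ℝ[X]) ^ m).natDegree = 2 * m := by
  have := natDegree_X_pow_sub_C (n := 2) (r := (1 : ℝ))
  rw [C_1] at this
  rw [natDegree_pow, this, mul_comm]

theorem card_univ_sdiff_path {l : List V} (hl : l.Nodup) :
    (Finset.univ \ l.toFinset).card + l.length = Fintype.card V := by
  rw [Finset.card_sdiff_of_subset (Finset.subset_univ _), List.toFinset_card_of_nodup hl,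
    Finset.card_univ]
  exact Nat.sub_add_cancel hl.length_le_card

theorem path_length_le {m : ℕ} (h : (X ^ 2 - 1) ^ (m + 1) ∣ muOn G Finset.univ) {l : List V}
    (hne : l ≠ []) (hc : l.IsChain G.Adj) (hl : l.Nodup) :
    2 * m + l.length ≤ Fintype.card V := by
  have h1 := natDegree_le_of_dvd (sq_sub_one_pow_dvd_muOn_sdiff_path G h hne hc hl)
    (muOn_monic G _).ne_zero
  rw [natDegree_sq_sub_one_pow, natDegree_muOn] at h1
  have := card_univ_sdiff_path hl
  omega

theorem muOn_sdiff_path_of_card_eq {m : ℕ} (h : (X ^ 2 - 1) ^ (m + 1) ∣ muOn G Finset.univ)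
    {l : List V} (hne : l ≠ []) (hc : l.IsChain G.Adj) (hl : l.Nodup)
    (hcard : Fintype.card V = 2 * m + l.length) :
    muOn G (Finset.univ \ l.toFinset) = (X ^ 2 - 1) ^ m := by
  have h1 := sq_sub_one_pow_dvd_muOn_sdiff_path G h hne hc hl
  have := card_univ_sdiff_path hl
  refine eq_of_monic_of_dvd_of_natDegree_le (monic_sq_sub_one_pow m) (muOn_monic G _) h1 ?_
  rw [natDegree_sq_sub_one_pow, natDegree_muOn]
  omega

/-- The cofactor of (X² - 1)^m is monic of degree one; as the polynomial of an odd number of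
vertices is odd, the cofactor has no constant term. -/
theorem muOn_sdiff_path_of_card_eq_add_one {m : ℕ}
    (h : (X ^ 2 - 1) ^ (m + 1) ∣ muOn G Finset.univ)
    {l : List V} (hne : l ≠ []) (hc : l.IsChain G.Adj) (hl : l.Nodup)
    (hcard : Fintype.card V = 2 * m + l.length + 1) :
    muOn G (Finset.univ \ l.toFinset) = X * (X ^ 2 - 1) ^ m := by
  obtain ⟨t, ht⟩ := sq_sub_one_pow_dvd_muOn_sdiff_path G h hne hc hl
  have hS := card_univ_sdiff_path hl
  have h1 : t.Monic := (monic_sq_sub_one_pow m).of_mul_monic_left (ht ▸ muOn_monic G _)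
  have h2 := natDegree_muOn G (Finset.univ \ l.toFinset)
  rw [ht, (monic_sq_sub_one_pow m).natDegree_mul h1, natDegree_sq_sub_one_pow] at h2
  have h3 := h1.eq_X_add_C (by omega)
  have h4 := eval_neg_muOn G (Finset.univ \ l.toFinset) 0
  rw [show (Finset.univ \ l.toFinset).card = 2 * m + 1 by omega, neg_zero, ht, h3] at h4
  simp [pow_succ, pow_mul] at h4
  have h5 : t.coeff 0 = 0 := by
    have h6 : ((-1 : ℝ) ^ m) ^ 2 = 1 := by rw [← pow_mul, mul_comm, pow_mul]; simp
    have h7 : ((-1 : ℝ) ^ m) ≠ 0 := by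
      intro h
      simp [h] at h6
    refine (mul_eq_zero.1 ?_).resolve_left h7
    linarith
  rw [ht, h3, h5]
  simp
  ring

end Paths

/-! ### Locating the centre from a path on four vertices -/

section Structure

variable {V : Type*} [DecidableEq V] [Fintype V] (G : SimpleGraph V)

/-- If no path has six vertices, the complement of every path on five vertices has no isolated
vertex, and the complement of the path `a b c d` consists of an isolated vertex `w` and
disjoint edges, one of which is attached to `b`, then the complement of `b` consists of disjoint
edges. -/
theorem inducesPerfectMatching_erase_of_path
    (h6 : ∀ l : List V, l.length = 6 → l.IsChain G.Adj → ¬ l.Nodup)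
    (h5 : ∀ l : List V, l.length = 5 → l.IsChain G.Adj → l.Nodup →
      ∀ v ∉ l, ∃ u, u ∉ l ∧ G.Adj v u)
    {a b c d w : V} (hP : [a, b, c, d].IsChain G.Adj) (hn : [a, b, c, d, w].Nodup)
    (hw : ∀ v, v ∉ [a, b, c, d] → ¬ G.Adj w v)
    (hB : InducesPerfectMatching G (Finset.univ \ [a, b, c, d, w].toFinset))
    {y : V} (hy : y ∉ [a, b, c, d, w]) (hyb : G.Adj y b) :
    InducesPerfectMatching G (Finset.univ.erase b) := by
  have hB' : ∀ v, v ∉ [a, b, c, d, w] → ∃ u, u ∉ [a, b, c, d, w] ∧ G.Adj v u ∧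
      ∀ x, x ∉ [a, b, c, d, w] → G.Adj v x → x = u := by
    intro v hv
    obtain ⟨u, ⟨hu, hvu⟩, huniq⟩ := hB v (by simpa using hv)
    exact ⟨u, by simpa using hu, hvu, fun x hx hvx => huniq x ⟨by simpa using hx, hvx⟩⟩
  simp only [List.isChain_cons_cons, List.IsChain.singleton, and_true] at hP
  obtain ⟨hab, hbc, hcd⟩ := hP
  have p6 : ∀ u v x y z t : V, [u, v, x, y, z, t].Nodup → G.Adj u v → G.Adj v x → G.Adj x y →
      G.Adj y z → G.Adj z t → False := by
    intro u v x y z t hn h1 h2 h3 h4 h5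
    exact h6 [u, v, x, y, z, t] rfl (by simp [h1, h2, h3, h4, h5]) hn
  have p5 : ∀ v x y z t : V, [v, x, y, z, t].Nodup → G.Adj v x → G.Adj x y →
      G.Adj y z → G.Adj z t → ∀ u, u ∉ [v, x, y, z, t] → ∃ q, q ∉ [v, x, y, z, t] ∧ G.Adj u q := by
    intro v x y z t hn h2 h3 h4 h6
    exact h5 [v, x, y, z, t] rfl (by simp [h2, h3, h4, h6]) hn
  clear h5 h6 hB
  obtain ⟨z, hz, hyz, hyu⟩ := hB' y hy
  simp only [List.mem_cons, List.not_mem_nil, or_false, not_or, List.nodup_cons,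
    List.nodup_nil] at *
  have hyz' := hyz.ne
  have sym : ∀ p q, G.Adj p q → G.Adj q p := fun _ _ h => h.symm
  have hBa : ∀ v, v ≠ a ∧ v ≠ b ∧ v ≠ c ∧ v ≠ d ∧ v ≠ w → ¬ G.Adj v a := by
    intro v hv hva
    obtain ⟨u, hu, hvu, -⟩ := hB' v hv
    have := hvu.ne
    exact p6 u v a b c d (by grind) hvu.symm hva hab hbc hcd
  have hBd : ∀ v, v ≠ a ∧ v ≠ b ∧ v ≠ c ∧ v ≠ d ∧ v ≠ w → ¬ G.Adj v d := by
    intro v hv hvd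
    obtain ⟨u, hu, hvu, -⟩ := hB' v hv
    have := hvu.ne
    exact p6 u v d c b a (by grind) hvu.symm hvd hcd.symm hbc.symm hab.symm
  -- The path z y b c d has five vertices, so `a` has a neighbour off it; the matched vertices are
  -- excluded, leaving only `w`.
  have haw : G.Adj a w := by
    obtain ⟨q, hq, haq⟩ := p5 z y b c d (by grind) hyz.symm hyb hbc hcd a (by grind)
    by_cases hqw : q = w
    · exact hqw ▸ haq
    · have := haq.ne
      exact absurd haq.symm (hBa q (by grind))
  -- For v = z and for v outside {y, z} there is a path on six vertices. For v = y the path a b y c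
  -- d would need a neighbour of z off it, but z has only y among the matched vertices and is not
  -- adjacent to w.
  have hBc : ∀ v, v ≠ a ∧ v ≠ b ∧ v ≠ c ∧ v ≠ d ∧ v ≠ w → ¬ G.Adj v c := by
    intro v hv hvc
    by_cases hvz : v = z
    · subst hvz
      exact p6 a b y v c d (by grind) hab hyb.symm hyz hvc hcd
    · by_cases hvy : v = y
      · subst hvy
        obtain ⟨q, hq, hzq⟩ := p5 a b v c d (by grind) hab hyb.symm hvc hcd z (by grind)
        by_cases hqw : q = w
        · subst hqw
          exact hw z (by grind) hzq.symm
        · obtain ⟨u, hu, hzu, huniq⟩ := hB' z hz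
          have h1 := huniq q (by grind) hzq
          have h2 := huniq v hv hyz.symm
          grind
      · obtain ⟨u, hu, hvu, huniq⟩ := hB' v hv
        have := hvu.ne
        have huy : u ≠ y := by
          rintro rfl
          exact hvz (hyu v hv hvu.symm)
        have huz : u ≠ z := by
          rintro rfl
          obtain ⟨u', hu', -, huniq'⟩ := hB' u hz
          have h1 := huniq' y hy hyz.symm
          have h2 := huniq' v hv hvu.symm
          grind
        by_cases huzz : u = z
        · exact huz huzz
        · exact p6 u v c b y z (by grind) hvu.symm hvc hbc.symm hyb.symm hyz
  -- Any edge between {a, w} and {c, d} extends z y b a to a path on six vertices. So off b only aw,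
  -- cd and the matched edges remain.
  have hac : ¬ G.Adj a c := fun h => p6 z y b a c d (by grind) hyz.symm hyb hab.symm h hcd
  have had : ¬ G.Adj a d := fun h => p6 z y b a d c (by grind) hyz.symm hyb hab.symm h hcd.symm
  have hwc : ¬ G.Adj w c := fun h => p6 z y b a w c (by grind) hyz.symm hyb hab.symm haw h
  have hwd : ¬ G.Adj w d := fun h => p6 z y b a w d (by grind) hyz.symm hyb hab.symm haw h
  intro v hv
  simp only [Finset.mem_erase, Finset.mem_univ, and_true] at hv ⊢
  clear p6 p5
  have hirr : ∀ x, G.Adj v x → x ≠ v := fun x h => h.ne.symm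
  by_cases hva : v = a
  · subst hva
    exact ⟨w, ⟨by grind, haw⟩, fun x hx => by_contra fun hxw =>
      hBa x (by have := hirr x hx.2; grind) hx.2.symm⟩
  by_cases hvw : v = w
  · subst hvw
    exact ⟨a, ⟨by grind, haw.symm⟩, fun x hx => by_contra fun hxw =>
      hw x (by have := hirr x hx.2; grind) hx.2⟩
  by_cases hvc : v = c
  · subst hvc
    exact ⟨d, ⟨by grind, hcd⟩, fun x hx => by_contra fun hxw =>
      hBc x (by have := hirr x hx.2; grind) hx.2.symm⟩
  by_cases hvd : v = d
  · subst hvd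
    exact ⟨c, ⟨by grind, hcd.symm⟩, fun x hx => by_contra fun hxw =>
      hBd x (by have := hirr x hx.2; grind) hx.2.symm⟩
  have hvB : v ≠ a ∧ v ≠ b ∧ v ≠ c ∧ v ≠ d ∧ v ≠ w := ⟨hva, hv, hvc, hvd, hvw⟩
  obtain ⟨u, hu, hvu, huniq⟩ := hB' v hvB
  refine ⟨u, ⟨hu.2.1, hvu⟩, fun x hx => huniq x ⟨?_, hx.1, ?_, ?_, ?_⟩ hx.2⟩
  · rintro rfl
    exact hBa v hvB hx.2
  · rintro rfl
    exact hBc v hvB hx.2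
  · rintro rfl
    exact hBd v hvB hx.2
  · rintro rfl
    exact hw v (by grind) hx.2.symm

end Structure

/-! ### Leaves and the multiplicity of the root 0 -/

section Leaves

variable {V : Type*} [DecidableEq V] (G : SimpleGraph V) [DecidableRel G.Adj]

theorem muOn_eq_of_isolated {S : Finset V} {x : V} (hx : x ∈ S) (h : ∀ v ∈ S, ¬ G.Adj x v) :
    muOn G S = X * muOn G (S.erase x) := by
  conv_lhs => rw [← Finset.insert_erase hx]
  exact muOn_insert_of_isolated G (Finset.notMem_erase x S)
    fun v hv => h v (Finset.mem_of_mem_erase hv)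

theorem muOn_eq_of_leaf {S : Finset V} {u x : V} (hx : x ∈ S) (hu : u ∈ S) (hxu : G.Adj x u)
    (h : ∀ v, G.Adj x v → v = u) :
    muOn G S = X * muOn G (S.erase x) - muOn G ((S.erase x).erase u) := by
  conv_lhs => rw [← Finset.insert_erase hx]
  exact muOn_insert_of_leaf G (Finset.notMem_erase x S)
    (Finset.mem_erase.2 ⟨hxu.ne.symm, hu⟩) hxu fun v _ => h v

/-- A matching covers at most one of three leaves with a common neighbour, so it misses at least two
vertices. -/
theorem X_sq_dvd_muOn_of_leaves {S : Finset V} {u x y z : V} (hn : [u, x, y, z].Nodup)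
    (hS : ∀ v ∈ [u, x, y, z], v ∈ S)
    (hu : ∀ v ∈ [x, y, z], G.Adj v u ∧ ∀ t, G.Adj v t → t = u) :
    X ^ 2 ∣ muOn G S := by
  simp only [List.mem_cons, List.not_mem_nil, or_false, not_or, List.nodup_cons, forall_eq_or_imp,
    forall_eq] at *
  obtain ⟨⟨hxu, hx⟩, ⟨hyu, hy⟩, ⟨hzu, hz⟩⟩ := hu
  obtain ⟨huS, hxS, hyS, hzS⟩ := hS
  rw [muOn_eq_of_leaf G hxS huS hxu hx, muOn_eq_of_leaf G (u := u) (x := y) (by simp; grind)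
    (by simp; grind) hyu hy,
    muOn_eq_of_isolated G (S := ((S.erase x).erase y).erase u) (x := z) (by simp; grind)
      (by simp; grind),
    muOn_eq_of_isolated G (S := (S.erase x).erase u) (x := y) (by simp; grind)
      (by simp; grind),
    muOn_eq_of_isolated G (S := ((S.erase x).erase u).erase y) (x := z) (by simp; grind)
      (by simp; grind)]
  refine dvd_sub ?_ ?_
  · rw [← mul_sub, pow_two]
    exact mul_dvd_mul_left _ (Dvd.intro _ rfl)
  · exact Dvd.intro _ (by rw [pow_two, mul_assoc])

/-- Three neighbours of `u` must be leaves: a further neighbour t of one of them, x, would give a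
path t x u v with v another of the three. -/
theorem X_sq_dvd_muOn_of_forall_path {S : Finset V} {u : V} (hS : ∀ v, v ∈ S)
    (hu : 3 ≤ (S.filter (G.Adj u)).card)
    (h4 : ∀ a b c d : V, G.Adj a b → G.Adj b c → G.Adj c d → ¬ [a, b, c, d].Nodup) :
    X ^ 2 ∣ muOn G S := by
  obtain ⟨T, hT, hT3⟩ := Finset.exists_subset_card_eq hu
  obtain ⟨x, y, z, hxy, hxz, hyz, rfl⟩ := Finset.card_eq_three.1 hT3
  have hx : G.Adj u x := (Finset.mem_filter.1 (hT (by simp))).2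
  have hy : G.Adj u y := (Finset.mem_filter.1 (hT (by simp))).2
  have hz : G.Adj u z := (Finset.mem_filter.1 (hT (by simp))).2
  have key : ∀ x y z, x ≠ y → x ≠ z → y ≠ z → G.Adj u x → G.Adj u y → G.Adj u z → ∀ t,
      G.Adj x t → t = u := by
    intro x y z hxy hxz hyz hx hy hz t hxt
    by_contra htu
    have := hxt.ne
    have := hx.ne
    have := hy.ne
    have := hz.ne
    by_cases hty : t = y
    · exact h4 t x u z hxt.symm hx.symm hz (by simp; grind)
    · exact h4 t x u y hxt.symm hx.symm hy (by simp; grind)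
  refine X_sq_dvd_muOn_of_leaves G (u := u) (x := x) (y := y) (z := z) ?_ (fun v _ => hS v) ?_
  · simp [hx.ne, hy.ne, hz.ne, hxy, hxz, hyz]
  · simp only [List.mem_cons, List.not_mem_nil, or_false, forall_eq_or_imp, forall_eq]
    exact ⟨⟨hx.symm, key x y z hxy hxz hyz hx hy hz⟩,
      ⟨hy.symm, key y x z hxy.symm hyz hxz hy hx hz⟩,
      ⟨hz.symm, key z x y hxz.symm hyz.symm hxy hz hx hy⟩⟩

end Leaves

/-! ### Finding the centre of a graph with the given polynomial -/

section Main

variable {V : Type*} [DecidableEq V] [Fintype V] (G : SimpleGraph V) [DecidableRel G.Adj]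

theorem coeff_muOn_graphS_form (k s : ℕ) :
    (X * (X ^ 2 - 1) ^ (k + 1) * (X ^ 2 - 1 - (s : ℝ[X]))).coeff (2 * k + 3) =
      -(k + 2 + s : ℝ) := by
  have h : (X * (X ^ 2 - 1) ^ (k + 1) * (X ^ 2 - 1 - (s : ℝ[X]))) =
      X * ((X ^ 2 - 1) ^ (k + 1 + 1) - C (s : ℝ) * (X ^ 2 - 1) ^ (k + 1)) := by
    simp
    ring
  have h2 : ((X ^ 2 - 1 : ℝ[X]) ^ (k + 1)).coeff (2 * (k + 1)) = 1 := by
    have := (monic_sq_sub_one_pow (k + 1)).coeff_natDegree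
    rwa [natDegree_sq_sub_one_pow] at this
  rw [h, show 2 * k + 3 = 2 * (k + 1) + 1 by ring, coeff_X_mul, coeff_sub, coeff_C_mul,
    coeff_sq_sub_one_pow, h2]
  push_cast
  ring

/-- There are k + 2 + s edges, more than the number of vertices, so some degree is at least 3.
Without a path on four vertices X² would divide the polynomial, but 0 is a simple root since s + 1 ≠
0. -/
theorem exists_path_of_muOn {k s : ℕ} (hcard : Fintype.card V = 2 * k + 5) (hs : k + 4 ≤ s)
    (hmu : muOn G Finset.univ = X * (X ^ 2 - 1) ^ (k + 1) * (X ^ 2 - 1 - (s : ℝ[X]))) :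
    ∃ a b c d : V, G.Adj a b ∧ G.Adj b c ∧ G.Adj c d ∧ [a, b, c, d].Nodup := by
  by_contra! h4
  have h1 := two_mul_coeff_muOn G Finset.univ (2 * k + 3) (by rw [Finset.card_univ, hcard])
  rw [hmu, coeff_muOn_graphS_form] at h1
  have h2 : ∃ u : V, 3 ≤ (Finset.univ.filter (G.Adj u)).card := by
    by_contra! h
    have h3 : ∑ v : V, (Finset.univ.filter (G.Adj v)).card ≤ ∑ v : V, 2 :=
      Finset.sum_le_sum fun v _ => Nat.lt_succ_iff.1 (h v)
    rw [Finset.sum_const, Finset.card_univ, hcard, smul_eq_mul] at h3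
    have h4 : 2 * (k + 2 + s) = ∑ v : V, (Finset.univ.filter (G.Adj v)).card := by
      have : (2 * (k + 2 + s) : ℝ) = ∑ v : V, ((Finset.univ.filter (G.Adj v)).card : ℝ) := by
        linarith
      exact_mod_cast this
    omega
  obtain ⟨u, hu⟩ := h2
  obtain ⟨t, ht⟩ := X_sq_dvd_muOn_of_forall_path G (fun v => Finset.mem_univ v) hu h4
  rw [hmu, pow_two, mul_assoc, mul_assoc] at ht
  have h5 := congrArg (eval 0) (mul_left_cancel₀ X_ne_zero ht)
  simp at h5
  have : (-1 - s : ℝ) < 0 := by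
    have : (0 : ℝ) ≤ s := Nat.cast_nonneg s
    linarith
  exact this.ne h5

theorem exists_inducesPerfectMatching_erase {k s : ℕ} (hcard : Fintype.card V = 2 * k + 5)
    (hs : k + 4 ≤ s) (hs6 : 6 ≤ s)
    (hmu : muOn G Finset.univ = X * (X ^ 2 - 1) ^ (k + 1) * (X ^ 2 - 1 - (s : ℝ[X]))) :
    ∃ b, InducesPerfectMatching G (Finset.univ.erase b) := by
  have hdvd : (X ^ 2 - 1) ^ (k + 1) ∣ muOn G Finset.univ := by
    rw [hmu, mul_assoc, mul_left_comm]
    exact Dvd.intro _ rfl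
  have h6 : ∀ l : List V, l.length = 6 → l.IsChain G.Adj → ¬ l.Nodup := by
    intro l hl hc hn
    have := path_length_le G hdvd (by rintro rfl; simp at hl) hc hn
    omega
  have h5 : ∀ l : List V, l.length = 5 → l.IsChain G.Adj → l.Nodup →
      ∀ v ∉ l, ∃ u, u ∉ l ∧ G.Adj v u := by
    intro l hl hc hn v hv
    have h := muOn_sdiff_path_of_card_eq G hdvd (by rintro rfl; simp at hl) hc hn (by omega)
    obtain ⟨u, hu, hvu⟩ := exists_adj_of_eval_zero_ne G
      (S := Finset.univ \ l.toFinset) (by simp [h]) (v := v) (by simpa using hv)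
    exact ⟨u, by simpa using hu, hvu⟩
  obtain ⟨a, b, c, d, hab, hbc, hcd, hn⟩ := exists_path_of_muOn G hcard hs hmu
  have hP : [a, b, c, d].IsChain G.Adj := by simp [hab, hbc, hcd]
  have hR := muOn_sdiff_path_of_card_eq_add_one G hdvd (by simp) hP hn (by simpa using hcard)
  have hRc : (Finset.univ \ [a, b, c, d].toFinset).card = 2 * k + 1 := by
    have := card_univ_sdiff_path hn
    simp only [List.length_cons, List.length_nil] at this
    omega
  obtain ⟨w, hwR, hw⟩ := exists_isolated_of_muOn hRc hR
  have hw' : ∀ v, v ∉ [a, b, c, d] → ¬ G.Adj w v := fun v hv => hw v (by simpa using hv)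
  have hwl : w ∉ [a, b, c, d] := by simpa using hwR
  have hn5 : [a, b, c, d, w].Nodup := by
    simp only [List.mem_cons, List.not_mem_nil, or_false, not_or, List.nodup_cons] at hn hwl ⊢
    grind
  have hBe : (Finset.univ \ [a, b, c, d].toFinset).erase w =
      Finset.univ \ [a, b, c, d, w].toFinset := by
    ext
    simp
    tauto
  have hBmu : muOn G (Finset.univ \ [a, b, c, d, w].toFinset) = (X ^ 2 - 1) ^ k := by
    rw [muOn_eq_of_isolated G hwR hw, hBe] at hR
    exact mul_left_cancel₀ X_ne_zero hR
  have hB : InducesPerfectMatching G (Finset.univ \ [a, b, c, d, w].toFinset) := by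
    refine inducesPerfectMatching_of_muOn ?_ hBmu
    rw [← hBe, Finset.card_erase_of_mem hwR, hRc, Nat.add_sub_cancel]
  by_cases hb : ∃ y, y ∉ [a, b, c, d, w] ∧ G.Adj y b
  · obtain ⟨y, hy, hyb⟩ := hb
    exact ⟨b, inducesPerfectMatching_erase_of_path G h6 h5 hP hn5 hw' hB hy hyb⟩
  by_cases hc : ∃ y, y ∉ [a, b, c, d, w] ∧ G.Adj y c
  · obtain ⟨y, hy, hyc⟩ := hc
    have hset : [d, c, b, a, w].toFinset = [a, b, c, d, w].toFinset := by
      ext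
      simp
      tauto
    refine ⟨c, inducesPerfectMatching_erase_of_path G h6 h5 (a := d) (b := c) (c := b) (d := a)
      (w := w) (by simp [hab.symm, hbc.symm, hcd.symm]) ?_ ?_ (by rwa [hset]) (y := y) ?_ hyc⟩
    · simp only [List.mem_cons, List.not_mem_nil, or_false, not_or, List.nodup_cons] at hn5 ⊢
      grind
    · exact fun v hv => hw' v (by simp at hv ⊢; tauto)
    · simp at hy ⊢
      tauto
  exfalso
  push Not at hb hc
  -- An edge from a or d to a matched vertex would extend to a path on six vertices, so the five
  -- vertices are separated from the rest.
  have hdisj : ∀ x ∈ ({a, b, c, d, w} : Finset V), ∀ y ∈ Finset.univ \ [a, b, c, d, w].toFinset,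
      ¬ G.Adj x y := by
    intro x hx y hy hxy
    obtain ⟨z, ⟨hz, hyz⟩, -⟩ := hB y hy
    have hy' : y ∉ [a, b, c, d, w] := by simpa using hy
    have hz' : z ∉ [a, b, c, d, w] := by simpa using hz
    have hne := hyz.ne
    simp only [Finset.mem_insert, Finset.mem_singleton] at hx
    rcases hx with rfl | rfl | rfl | rfl | rfl
    · exact h6 [z, y, x, b, c, d] rfl (by simp [hyz.symm, hxy.symm, hab, hbc, hcd])
        (by simp at hn5 hy' hz' ⊢; grind)
    · exact hb y hy' hxy.symm
    · exact hc y hy' hxy.symm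
    · exact h6 [z, y, x, c, b, a] rfl
        (by simp [hyz.symm, hxy.symm, hab.symm, hbc.symm, hcd.symm])
        (by simp at hn5 hy' hz' ⊢; grind)
    · exact hw' y (by simp at hy' ⊢; tauto) hxy
  have hset : [a, b, c, d, w].toFinset = {a, b, c, d, w} := by
    simp
  have hun := muOn_union G (S := {a, b, c, d, w})
    (T := Finset.univ \ [a, b, c, d, w].toFinset)
    (by rw [hset]; exact Finset.disjoint_sdiff) hdisj
  rw [hset, Finset.union_sdiff_of_subset (Finset.subset_univ _), hmu, ← hset, hBmu, hset,
    pow_succ] at hun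
  have hmu5 : muOn G {a, b, c, d, w} = X * (X ^ 2 - 1) * (X ^ 2 - 1 - (s : ℝ[X])) := by
    refine mul_right_cancel₀ (monic_sq_sub_one_pow k).ne_zero ?_
    rw [← hun]
    ring
  have := le_five_of_muOn_quintuple G hn5 hmu5
  omega

theorem card_filter_adj_of_muOn {k s : ℕ} (hcard : Fintype.card V = 2 * k + 3) {b : V}
    (hb : InducesPerfectMatching G (Finset.univ.erase b))
    (hmu : muOn G Finset.univ = X * (X ^ 2 - 1) ^ k * (X ^ 2 - 1 - (s : ℝ[X]))) :
    (Finset.univ.filter (G.Adj b)).card = s := by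
  have hc : (Finset.univ.erase b).card = 2 * (k + 1) := by
    rw [Finset.card_erase_of_mem (Finset.mem_univ b), Finset.card_univ, hcard]
    omega
  have h := hb.muOn_insert hc k.succ_pos (Finset.notMem_erase b _)
  rw [Finset.insert_erase (Finset.mem_univ b), hmu, Nat.add_sub_cancel] at h
  have h1 := mul_left_cancel₀ (mul_ne_zero X_ne_zero (monic_sq_sub_one_pow k).ne_zero) h
  have h2 : s = ((Finset.univ.erase b).filter (G.Adj b)).card := by
    exact_mod_cast sub_right_injective h1
  rw [h2]
  congr 1
  ext x
  simp only [Finset.mem_filter, Finset.mem_univ, Finset.mem_erase, true_and, and_true]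
  exact ⟨fun h => ⟨h.ne.symm, h⟩, fun h => h.2⟩

end Main

/-! ### The isomorphism with `graphS` -/

section IsoGraphS

/-- The smaller element of each pair {v, σ v} is chosen, for an ordering in which `v₀` comes last;
hence `v₀` is never chosen. -/
theorem exists_transversal {V : Type*} [Fintype V] (P : V → Prop) (σ : V → V)
    (hσP : ∀ v, P v → P (σ v)) (hσ : ∀ v, P v → σ (σ v) = v) (hne : ∀ v, P v → σ v ≠ v) (v₀ : V) :
    ∃ A : Finset V, v₀ ∉ A ∧ (∀ v ∈ A, P v) ∧ ∀ v, P v → (v ∈ A ↔ σ v ∉ A) := by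
  classical
  let key : V → ℕ := fun v => if v = v₀ then Fintype.card V else Fintype.equivFin V v
  have hkey : Function.Injective key := by
    intro v w h
    simp only [key] at h
    split_ifs at h with h1 h2 h2
    · rw [h1, h2]
    · exact absurd h.symm (Fintype.equivFin V w).2.ne
    · exact absurd h (Fintype.equivFin V v).2.ne
    · exact (Fintype.equivFin V).injective (Fin.ext h)
  have hmax : ∀ v, key v ≤ key v₀ := by
    intro v
    simp only [key, if_true]
    split_ifs
    · exact le_rfl
    · exact (Fintype.equivFin V v).2.le
  refine ⟨Finset.univ.filter fun v => P v ∧ key v < key (σ v), ?_, ?_, ?_⟩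
  · simp only [Finset.mem_filter, not_and, not_lt, Finset.mem_univ, true_and]
    exact fun _ => hmax _
  · simp only [Finset.mem_filter, Finset.mem_univ, true_and]
    exact fun v hv => hv.1
  · intro v hv
    simp only [Finset.mem_filter, Finset.mem_univ, true_and, hv, hσP v hv, hσ v hv, not_lt]
    refine ⟨fun h => h.le, fun h => lt_of_le_of_ne h fun h' => hne v hv (hkey h'.symm)⟩

variable {V : Type*} [DecidableEq V] [Fintype V] (G : SimpleGraph V) [DecidableRel G.Adj]

theorem nonempty_iso_graphS {k s : ℕ} (hs : s = 2 * k + 2 ∨ s = 2 * k + 1)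
    (hcard : Fintype.card V = 2 * k + 3) {b : V}
    (hb : InducesPerfectMatching G (Finset.univ.erase b))
    (hdeg : (Finset.univ.filter (G.Adj b)).card = s) : Nonempty (graphS (k + 1) s ≃g G) := by
  have hce : (Finset.univ.erase b).card = 2 * k + 2 := by
    rw [Finset.card_erase_of_mem (Finset.mem_univ b), Finset.card_univ, hcard]
    rfl
  have hsub : Finset.univ.filter (G.Adj b) ⊆ Finset.univ.erase b := by
    intro x hx
    simp only [Finset.mem_filter, Finset.mem_univ, true_and, Finset.mem_erase, and_true] at hx ⊢
    exact hx.ne.symm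
  -- For odd s this is the unique vertex missed by b; for even s it is arbitrary, which lets both
  -- cases share one construction.
  obtain ⟨v₀, hv₀, hbv, hbv₀⟩ : ∃ v₀, v₀ ≠ b ∧ (∀ v, v ≠ b → v ≠ v₀ → G.Adj b v) ∧
      (G.Adj b v₀ ↔ s = 2 * k + 2) := by
    rcases hs with hs | hs
    · have heq := Finset.eq_of_subset_of_card_le hsub (by omega)
      have hadj : ∀ v, v ≠ b → G.Adj b v := fun v hv => by
        have : v ∈ Finset.univ.filter (G.Adj b) := heq ▸ by simp [hv]
        simpa using this
      obtain ⟨v₀, hv₀⟩ : (Finset.univ.erase b).Nonempty := Finset.card_pos.1 (by omega)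
      have hv₀ := Finset.ne_of_mem_erase hv₀
      exact ⟨v₀, hv₀, fun v hv _ => hadj v hv, by simp [hadj v₀ hv₀, hs]⟩
    · have h1 : (Finset.univ.erase b \ Finset.univ.filter (G.Adj b)).card = 1 := by
        rw [Finset.card_sdiff_of_subset hsub]
        omega
      obtain ⟨v₀, hv₀⟩ := Finset.card_eq_one.1 h1
      have h2 : ∀ v, (v ≠ b ∧ ¬ G.Adj b v) ↔ v = v₀ := fun v => by
        rw [← Finset.mem_singleton, ← hv₀]
        simp
      have h3 := (h2 v₀).2 rfl
      exact ⟨v₀, h3.1, fun v hv hvv => by_contra fun h => hvv ((h2 v).1 ⟨hv, h⟩),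
        by simp [h3.2, hs]⟩
  have hex : ∀ v, ∃ u, v ≠ b → u ≠ b ∧ ∀ w, w ≠ b → (G.Adj v w ↔ w = u) := by
    intro v
    by_cases hv : v = b
    · exact ⟨v, fun h => absurd hv h⟩
    · obtain ⟨u, ⟨hu, hvu⟩, huniq⟩ := hb v (by simp [hv])
      exact ⟨u, fun _ => ⟨Finset.ne_of_mem_erase hu, fun w hw =>
        ⟨fun h => huniq w ⟨by simp [hw], h⟩, by rintro rfl; exact hvu⟩⟩⟩
  choose σ hσ using hex
  have hσb : ∀ v, v ≠ b → σ v ≠ b := fun v hv => (hσ v hv).1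
  have hadj : ∀ v w, v ≠ b → w ≠ b → (G.Adj v w ↔ w = σ v) := fun v w hv => (hσ v hv).2 w
  have hσσ : ∀ v, v ≠ b → σ (σ v) = v := fun v hv =>
    ((hadj (σ v) v (hσb v hv) hv).1 ((hadj v (σ v) hv (hσb v hv)).2 rfl).symm).symm
  have hσne : ∀ v, v ≠ b → σ v ≠ v := fun v hv => by
    have := ((hadj v (σ v) hv (hσb v hv)).2 rfl).ne
    exact this.symm
  obtain ⟨A, hv₀A, hAb, hA⟩ := exists_transversal (fun v => v ≠ b) σ hσb hσσ hσne v₀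
  have hAcard : A.card = k + 1 := by
    have h1 : Finset.univ.erase b \ A = A.image σ := by
      ext v
      simp only [Finset.mem_sdiff, Finset.mem_erase, Finset.mem_univ, and_true, Finset.mem_image]
      constructor
      · rintro ⟨hvb, hvA⟩
        exact ⟨σ v, by_contra fun h => hvA ((hA v hvb).2 h), hσσ v hvb⟩
      · rintro ⟨u, hu, rfl⟩
        exact ⟨hσb u (hAb u hu), (hA u (hAb u hu)).1 hu⟩
    have h2 : (A.image σ).card = A.card := Finset.card_image_of_injOn fun v hv w hw h => by
      rw [← hσσ v (hAb v hv), ← hσσ w (hAb w hw), h]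
    have h3 := Finset.card_sdiff_add_card_eq_card (s := A) (t := Finset.univ.erase b)
      fun v hv => by simp [hAb v hv]
    rw [h1, h2] at h3
    omega
  have hσv₀ : σ v₀ ∈ A := by
    by_contra h
    exact hv₀A ((hA v₀ hv₀).2 h)
  -- The only vertex of the model that its centre can miss is `some (Fin.last k, 1)`, so the edge of
  -- v₀ must receive the last index.
  obtain ⟨g, hg⟩ : ∃ g : Fin (k + 1) ≃ A, g (Fin.last k) = ⟨σ v₀, hσv₀⟩ := by
    let g₀ := (A.equivFinOfCardEq hAcard).symm
    refine ⟨(Equiv.swap (Fin.last k) (g₀.symm ⟨σ v₀, hσv₀⟩)).trans g₀, ?_⟩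
    simp
  have hgb : ∀ i, (g i : V) ≠ b := fun i => hAb _ (g i).2
  have hgA : ∀ i j, (g i : V) ≠ σ (g j) := fun i j h =>
    (hA _ (hgb j)).1 (g j).2 (h ▸ (g i).2)
  have hginj : ∀ i j, (g i : V) = g j ↔ i = j := fun i j => by
    rw [Subtype.coe_inj, g.injective.eq_iff]
  have hσinj : ∀ i j, σ (g i) = σ (g j) ↔ i = j := fun i j => by
    rw [← hginj]
    refine ⟨fun h => ?_, fun h => by rw [h]⟩
    rw [← hσσ _ (hgb i), ← hσσ _ (hgb j), h]
  let F : Option (Fin (k + 1) × Fin 2) → V := fun x => match x with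
    | none => b
    | some (i, a) => if a = 0 then g i else σ (g i)
  have hF : Function.Bijective F := by
    rw [Fintype.bijective_iff_injective_and_card]
    refine ⟨?_, by simp [hcard]; omega⟩
    rintro (_ | ⟨i, a⟩) (_ | ⟨j, c⟩) h
    · rfl
    · simp only [F] at h
      split_ifs at h
      · exact absurd h.symm (hgb j)
      · exact absurd h.symm (hσb _ (hgb j))
    · simp only [F] at h
      split_ifs at h
      · exact absurd h (hgb i)
      · exact absurd h (hσb _ (hgb i))
    · simp only [F] at h
      split_ifs at h with ha hc hc
      · rw [(hginj i j).1 h, ha, hc]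
      · exact absurd h (hgA i j)
      · exact absurd h.symm (hgA j i)
      · rw [(hσinj i j).1 h, show a = c by omega]
  have hnone : ∀ i a, G.Adj b (F (some (i, a))) ↔ (a = 0 ∨ (k + 1) + (i : ℕ) < s) := by
    intro i a
    by_cases ha : a = 0
    · simp only [F, ha, true_or, iff_true, if_true]
      exact hbv _ (hgb i) fun h => hv₀A (h ▸ (g i).2)
    · simp only [F, ha, false_or, if_false]
      by_cases hi : i = Fin.last k
      · rw [hi, hg, hσσ _ hv₀, hbv₀, Fin.val_last]
        omega
      · have h1 : σ (g i) ≠ v₀ := by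
          intro h
          refine hi ((hginj _ _).1 ?_)
          rw [hg]
          change (g i : V) = σ v₀
          rw [← h, hσσ _ (hgb i)]
        have h2 : (i : ℕ) < k := Fin.val_lt_last hi
        simp only [hbv _ (hσb _ (hgb i)) h1, true_iff]
        omega
  refine ⟨⟨Equiv.ofBijective F hF, ?_⟩⟩
  rintro (_ | ⟨i, a⟩) (_ | ⟨j, c⟩)
  · simp [graphS]
  · exact hnone j c
  · rw [G.adj_comm]
    exact hnone i a
  · simp only [Equiv.ofBijective_apply, F, graphS]
    split_ifs with ha hc hc
    · rw [hadj _ _ (hgb i) (hgb j)]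
      simp [ha, hc, hgA]
    · rw [hadj _ _ (hgb i) (hσb _ (hgb j)), hσinj]
      simp [ha, Ne.symm hc, eq_comm]
    · rw [hadj _ _ (hσb _ (hgb i)) (hgb j), hσσ _ (hgb i), hginj]
      simp [hc, ha, eq_comm]
    · rw [hadj _ _ (hσb _ (hgb i)) (hσb _ (hgb j)), hσσ _ (hgb i)]
      have hac : a = c := by omega
      simp [hac, (hgA _ _).symm]

end IsoGraphS

/-! ### The polynomial of `graphS`, uniqueness and friendship graphs -/

section GraphS

instance (r s : ℕ) : DecidableRel (graphS r s).Adj := fun x y => match x, y with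
  | none, none => inferInstanceAs (Decidable False)
  | none, some (i, a) => inferInstanceAs (Decidable (a = 0 ∨ r + i < s))
  | some (i, a), none => inferInstanceAs (Decidable (a = 0 ∨ r + i < s))
  | some (i, a), some (j, b) => inferInstanceAs (Decidable (i = j ∧ a ≠ b))

theorem inducesPerfectMatching_graphS (r s : ℕ) :
    InducesPerfectMatching (graphS r s) (Finset.univ.erase none) := by
  rintro (_ | ⟨i, a⟩) hv
  · simp at hv
  · refine ⟨some (i, 1 - a), ⟨by simp, rfl, by omega⟩, ?_⟩
    rintro (_ | ⟨j, c⟩) ⟨hu, h⟩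
    · simp at hu
    · obtain ⟨rfl, hac⟩ := h
      rw [show c = 1 - a by omega]

theorem card_filter_adj_none_graphS {r s : ℕ} (h1 : r ≤ s) (h2 : s ≤ 2 * r) :
    ((Finset.univ.erase none).filter ((graphS r s).Adj none)).card = s := by
  have h3 : ((Finset.univ.erase none).filter ((graphS r s).Adj none)).card =
      ∑ x, if (graphS r s).Adj none x then 1 else 0 := by
    rw [Finset.card_filter, Finset.sum_erase]
    simp
  have h4 : ∑ i : Fin r, (if r + (i : ℕ) < s then 1 else 0) = s - r := by
    rw [Fin.sum_univ_eq_sum_range (fun i => if r + i < s then 1 else 0), ← Finset.card_filter]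
    have : (Finset.range r).filter (fun i => r + i < s) = Finset.range (s - r) := by
      ext i
      simp only [Finset.mem_filter, Finset.mem_range]
      omega
    rw [this, Finset.card_range]
  rw [h3, Fintype.sum_option, Fintype.sum_prod_type]
  simp only [Fin.sum_univ_two, Finset.sum_add_distrib]
  simp only [graphS, true_or, if_true, one_ne_zero, false_or, h4]
  simp
  omega

theorem muOn_graphS {k s : ℕ} (h1 : k + 1 ≤ s) (h2 : s ≤ 2 * (k + 1)) :
    muOn (graphS (k + 1) s) Finset.univ =
      X * (X ^ 2 - 1) ^ k * (X ^ 2 - 1 - (s : ℝ[X])) := by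
  have h := (inducesPerfectMatching_graphS (k + 1) s).muOn_insert (c := k + 1)
    (by simp; omega) k.succ_pos (Finset.notMem_erase none _)
  rwa [Finset.insert_erase (Finset.mem_univ _), card_filter_adj_none_graphS h1 h2] at h

/-- The second coefficient forces an edge; the third vertex serves as b. -/
theorem exists_inducesPerfectMatching_erase_of_card_eq_three {V : Type*} [DecidableEq V]
    [Fintype V] (G : SimpleGraph V) [DecidableRel G.Adj] {s : ℕ} (hcard : Fintype.card V = 3)
    (hmu : muOn G Finset.univ = X * (X ^ 2 - 1 - (s : ℝ[X]))) :
    ∃ b, InducesPerfectMatching G (Finset.univ.erase b) := by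
  have h1 := two_mul_coeff_muOn G Finset.univ (0 + 1) (by rw [Finset.card_univ, hcard])
  obtain ⟨x, y, hxy⟩ : ∃ x y, G.Adj x y := by
    by_contra! h
    rw [hmu, coeff_X_mul] at h1
    simp [h] at h1
    have : (0 : ℝ) ≤ s := Nat.cast_nonneg s
    linarith
  have h2 : (({x, y} : Finset V)ᶜ).card = 1 := by
    rw [Finset.card_compl, Finset.card_pair hxy.ne, hcard]
  obtain ⟨b, hb⟩ := Finset.card_eq_one.1 h2
  refine ⟨b, ?_⟩
  have h3 : Finset.univ.erase b = {x, y} := by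
    rw [← compl_compl ({x, y} : Finset V), hb, Finset.compl_singleton]
  rw [h3]
  intro v hv
  simp only [Finset.mem_insert, Finset.mem_singleton] at hv
  rcases hv with rfl | rfl
  · exact ⟨y, ⟨by simp, hxy⟩, by simp⟩
  · exact ⟨x, ⟨by simp, hxy.symm⟩, by simp⟩

theorem matchingUnique_graphS {k s : ℕ} (hs : s = 2 * k + 2 ∨ s = 2 * k + 1)
    (hs6 : s ≤ 2 ∨ 6 ≤ s) : MatchingUnique (graphS (k + 1) s) := by
  classical
  intro W _ H hH
  obtain ⟨hiso, hpoly⟩ := hH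
  have := Fintype.ofFinite W
  have hmu : muOn H Finset.univ = X * (X ^ 2 - 1) ^ k * (X ^ 2 - 1 - (s : ℝ[X])) := by
    rw [← (matchingPolynomial_eq_iff _ _).1 hpoly, muOn_graphS (by omega) (by omega)]
  have hcard : Fintype.card W = 2 * k + 3 := by
    have h1 := natDegree_muOn H Finset.univ
    rw [← (matchingPolynomial_eq_iff _ _).1 hpoly, natDegree_muOn, Finset.card_univ,
      Finset.card_univ] at h1
    rw [← h1]
    simp
    omega
  obtain ⟨b, hb⟩ : ∃ b, InducesPerfectMatching H (Finset.univ.erase b) := by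
    rcases hs6 with hs6 | hs6
    · obtain rfl : k = 0 := by omega
      exact exists_inducesPerfectMatching_erase_of_card_eq_three H hcard (by simpa using hmu)
    · obtain ⟨m, rfl⟩ : ∃ m, k = m + 1 := ⟨k - 1, by omega⟩
      exact exists_inducesPerfectMatching_erase H (by omega) (by omega) hs6 hmu
  obtain ⟨e⟩ := nonempty_iso_graphS H hs hcard hb (card_filter_adj_of_muOn H hcard hb hmu)
  exact hiso.false e

theorem friendshipGraph_eq_graphS (n : ℕ) : friendshipGraph n = graphS n (2 * n) := by
  ext x y
  rcases x with _ | ⟨i, a⟩ <;> rcases y with _ | ⟨j, c⟩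
  · simp [friendshipGraph, graphS]
  · simp only [friendshipGraph, graphS]
    have h1 : n + (j : ℕ) < 2 * n := by omega
    simp only [h1, or_true, iff_true]
    refine ⟨by simp, j, by simp, ?_⟩
    fin_cases c <;> simp
  · simp only [friendshipGraph, graphS]
    have h1 : n + (i : ℕ) < 2 * n := by omega
    simp only [h1, or_true, iff_true]
    refine ⟨by simp, i, ?_, by simp⟩
    fin_cases a <;> simp
  · simp only [friendshipGraph, graphS, Set.mem_insert_iff, Set.mem_singleton_iff, reduceCtorEq,
      false_or, Option.some.injEq, Prod.mk.injEq, ne_eq, not_and]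
    constructor
    · rintro ⟨h, l, hi, hj⟩
      have hij : i = j := by rcases hi with hi | hi <;> rcases hj with hj | hj <;> rw [hi.1, hj.1]
      exact ⟨hij, h hij⟩
    · rintro ⟨rfl, h⟩
      refine ⟨fun _ => h, i, ?_, ?_⟩
      · fin_cases a <;> simp
      · fin_cases c <;> simp

end GraphS

/-! ### Comates for s = 3, 4, 5 -/

section Comates

/-- Matching uniqueness quantifies over an arbitrary universe, so the concrete comate has to be
lifted to it. -/
theorem not_matchingUnique_of_muOn_eq {V : Type*} [Fintype V] {n : ℕ} {G : SimpleGraph V}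
    {H : SimpleGraph (Fin n)} (hiso : IsEmpty (G ≃g H))
    (hmu : muOn G Finset.univ = muOn H Finset.univ) : ¬ MatchingUnique.{w} G := by
  classical
  intro h
  let e : H.comap (ULift.down : ULift.{w} (Fin n) → Fin n) ≃g H :=
    ⟨Equiv.ulift, Iff.rfl⟩
  refine h (ULift.{w} (Fin n)) (H.comap ULift.down) ⟨⟨fun f => hiso.false (f.trans e)⟩, ?_⟩
  rw [matchingPolynomial_eq_iff, hmu, ← muOn_map H (H.comap ULift.down)
    (Equiv.ulift : ULift.{w} (Fin n) ≃ Fin n).symm.toEmbedding fun _ _ => Iff.rfl]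
  simp

/-- The graph on `Fin n` with the edges of a list. -/
def listGraph (n : ℕ) (l : List (Fin n × Fin n)) : SimpleGraph (Fin n) where
  Adj x y := x ≠ y ∧ ((x, y) ∈ l ∨ (y, x) ∈ l)
  symm := ⟨fun _ _ h => ⟨h.1.symm, h.2.symm⟩⟩
  loopless := ⟨fun _ h => h.1 rfl⟩

instance (n : ℕ) (l : List (Fin n × Fin n)) : DecidableRel (listGraph n l).Adj := fun x y =>
  inferInstanceAs (Decidable (x ≠ y ∧ ((x, y) ∈ l ∨ (y, x) ∈ l)))

/-- The comate is a 4-cycle with a pendant edge, which has no triangle. -/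
theorem not_matchingUnique_graphS_two_three : ¬ MatchingUnique.{w} (graphS 2 3) := by
  refine not_matchingUnique_of_muOn_eq
    (H := listGraph 5 [(0, 1), (1, 2), (2, 3), (0, 3), (0, 4)]) ⟨fun e => ?_⟩ ?_
  · have h : ∀ x y z, (listGraph 5 [(0, 1), (1, 2), (2, 3), (0, 3), (0, 4)]).Adj x y →
        (listGraph 5 [(0, 1), (1, 2), (2, 3), (0, 3), (0, 4)]).Adj y z →
        ¬ (listGraph 5 [(0, 1), (1, 2), (2, 3), (0, 3), (0, 4)]).Adj x z := by decide
    exact h (e none) (e (some (0, 0))) (e (some (0, 1))) (e.map_adj_iff.2 (by decide))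
      (e.map_adj_iff.2 (by decide)) (e.map_adj_iff.2 (by decide))
  · rw [muOn_graphS (k := 1) (by norm_num) (by norm_num),
      show (Finset.univ : Finset (Fin 5)) = {0, 1, 2, 3, 4} from rfl,
      muOn_quintuple _ (by decide)]
    simp [adjInd, listGraph]
    ring

/-- The comate is K₄ minus an edge with a pendant edge at a vertex of degree two; it has no vertex
adjacent to all others. -/
theorem not_matchingUnique_graphS_two_four : ¬ MatchingUnique.{w} (graphS 2 4) := by
  refine not_matchingUnique_of_muOn_eq
    (H := listGraph 5 [(0, 1), (1, 2), (2, 3), (0, 3), (0, 2), (1, 4)]) ⟨fun e => ?_⟩ ?_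
  · have h : ∀ x, ∃ y, y ≠ x ∧
        ¬ (listGraph 5 [(0, 1), (1, 2), (2, 3), (0, 3), (0, 2), (1, 4)]).Adj x y := by decide
    have h' : ∀ y, y ≠ none → (graphS 2 4).Adj none y := by decide
    obtain ⟨y, hy, hey⟩ := h (e none)
    refine hey ?_
    rw [← e.apply_symm_apply y]
    exact e.map_adj_iff.2 (h' _ fun h => hy (by rw [← h, e.apply_symm_apply]))
  · rw [muOn_graphS (k := 1) (by norm_num) (by norm_num),
      show (Finset.univ : Finset (Fin 5)) = {0, 1, 2, 3, 4} from rfl,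
      muOn_quintuple _ (by decide)]
    simp [adjInd, listGraph]
    ring

/-- The comate is K₄ with a pendant edge, together with a disjoint edge; its five-vertex part
attains the bound of `le_five_of_muOn_quintuple`. -/
theorem not_matchingUnique_graphS_three_five : ¬ MatchingUnique.{w} (graphS 3 5) := by
  refine not_matchingUnique_of_muOn_eq
    (H := listGraph 7 [(0, 1), (0, 2), (0, 3), (1, 2), (1, 3), (2, 3), (0, 4), (5, 6)])
    ⟨fun e => ?_⟩ ?_
  · have h : ∀ x t, ∃ y, y ≠ x ∧ y ≠ t ∧ ¬ (listGraph 7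
        [(0, 1), (0, 2), (0, 3), (1, 2), (1, 3), (2, 3), (0, 4), (5, 6)]).Adj x y := by decide
    have h' : ∀ y, y ≠ none → y ≠ some (2, 1) → (graphS 3 5).Adj none y := by decide
    obtain ⟨y, hy, hy', hey⟩ := h (e none) (e (some (2, 1)))
    refine hey ?_
    rw [← e.apply_symm_apply y]
    exact e.map_adj_iff.2 (h' _ (fun h => hy (by rw [← h, e.apply_symm_apply]))
      fun h => hy' (by rw [← h, e.apply_symm_apply]))
  · rw [muOn_graphS (k := 2) (by norm_num) (by norm_num),
      show (Finset.univ : Finset (Fin 7)) = {0, 1, 2, 3, 4} ∪ {5, 6} from rfl,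
      muOn_union _ (by decide) (by decide), muOn_quintuple _ (by decide),
      muOn_pair _ (by decide)]
    simp [adjInd, listGraph]
    ring

end Comates

/-! ### The theorem -/

theorem mainTheorem5 :
    (∀ s : ℕ, 0 < s →
      (MatchingUnique.{w} (graphS ⌈(s : ℚ) / 2⌉₊ s) ↔ s ∉ ({3, 4, 5} : Set ℕ))) ∧
    (∀ n : ℕ, 0 < n →
      Nonempty (friendshipGraph n ≃g graphS n (2 * n)) ∧
      (n ≠ 2 → MatchingUnique.{w} (friendshipGraph n))) := by
  have hceil : ∀ k s : ℕ, s = 2 * k + 2 ∨ s = 2 * k + 1 → ⌈(s : ℚ) / 2⌉₊ = k + 1 := by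
    intro k s h
    rw [Nat.ceil_eq_iff k.succ_ne_zero, lt_div_iff₀ two_pos, div_le_iff₀ two_pos]
    rcases h with rfl | rfl <;> push_cast <;> constructor <;> linarith
  refine ⟨fun s hs => ?_, fun n hn => ⟨friendshipGraph_eq_graphS n ▸ ⟨SimpleGraph.Iso.refl⟩,
    fun h2 => ?_⟩⟩
  · obtain ⟨k, hk⟩ : ∃ k, s = 2 * k + 2 ∨ s = 2 * k + 1 := ⟨(s - 1) / 2, by omega⟩
    rw [hceil k s hk]
    constructor
    · rintro h (rfl | rfl | rfl)
      · obtain rfl : k = 1 := by omega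
        exact not_matchingUnique_graphS_two_three h
      · obtain rfl : k = 1 := by omega
        exact not_matchingUnique_graphS_two_four h
      · obtain rfl : k = 2 := by omega
        exact not_matchingUnique_graphS_three_five h
    · intro h
      simp only [Set.mem_insert_iff, Set.mem_singleton_iff, not_or] at h
      exact matchingUnique_graphS hk (by omega)
  · rw [friendshipGraph_eq_graphS]
    obtain ⟨k, rfl⟩ : ∃ k, n = k + 1 := ⟨n - 1, by omega⟩
    exact matchingUnique_graphS (Or.inl (by ring)) (by omega)
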